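/- Let $H$ be a separable real Hilbert space and let $V\subset H$ be a dense subspace which is itself a separable Hilbert space. Let $P$ be a skew-adjoint operator in $H$ with domain $V$ whose graph norm is equivalent to $\|\cdot\|_V$. Call $Q:\mathbb R\to\mathcal B(H)$ a *causal kernel* if $Q\in L^1(\mathbb R,\mathcal B_{\rm symm}(H))$ (every $Q(t)$ is bounded and self-adjoint), $Q$ is norm-continuous on $[0,\infty)$, and $Q(t)=0$ for $t<0$; its memory operator is $R[u](t)=\int Q(t-s)u(s)\,ds$, with formal adjoint $R^*[\phi](t)=\int Q(s-t)\phi(s)\,ds$. Let $\mathcal P$ be the set of triples $(A,B,Q)$ such that $A\in\mathcal B(H)$ is self-adjoint with $C_*I\le A\le C^*I$ for some $0<C_*\le C^*$, $B\in\mathcal B(H)$, and $Q$ is a causal kernel with $\|Q\|_{L^1}+\|Q\|_{L^\infty}<\infty$. A function on $\mathbb R$ is *causal* if it vanishes on some half-axis $(-\infty,T_1)$, and $L^2_+(\mathbb R,H)$ denotes the functions that are square integrable on every half-axis $(-\infty,T_1]$. For the equation $$Au'+Pu+Bu+R[u]=f, \qquad (1)$$ a *strong solution* is a function $u\in C^1(\mathbb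 R,H)\cap C^0(\mathbb R,V)\cap L^2_+(\mathbb R,H)$ satisfying (1) at every $t$, and a *weak solution* is a function $u\in L^2_+(\mathbb R,H)$ with $$\int\langle u,\,A\phi'+P\phi-B^*\phi-R^*[\phi]\rangle\,dt=-\int\langle f,\phi\rangle\,dt\quad\text{for all }\phi\in C_0^\infty(\mathbb R,V).$$ Let $(A,B,Q)\in\mathcal P$, let $f\in H^1(\mathbb R,H)$ be causal (and identified with its continuous representative), let $\delta A,\delta B\in\mathcal B(H)$ with $\delta A$ self-adjoint, and let $\delta Q$ be a causal kernel, with memory operator $\delta R$. For $h\in\mathbb R$ put $A_h=A+h\,\delta A$, $B_h=B+h\,\delta B$, $Q_h=Q+h\,\delta Q$. **Theorem.** (i) Equation (1) with coefficients $A,P,B,Q$ and right-hand side $f$ has a unique causal strong solution $u$. (ii) There is $h_0>0$ such that for all $|h|<h_0$: $A_h$ is bounded, self-adjoint and coercive and $Q_h$ is a causal kernel; if moreover $\delta Q$ is bounded, then $(A_h,B_h,Q_h)\in\mathcal P$; and (whether or not $\delta Q$ is bounded) equation (1) with coefficients $A_h,P,B_h,Q_h$ and the same right-hand side $f$ has a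 unique causal strong solution $u_h$. (iii) The linearized equation $$A\,\delta u'+P\,\delta u+B\,\delta u+R[\delta u]=-\delta A\,u'-\delta B\,u-\delta R[u]$$ has a causal weak solution $\delta u\in C^0(\mathbb R,H)$, which is unique (almost everywhere) among causal weak solutions. (iv) For all real $T_0\le T$, $$\lim_{h\to0}\Big\|\frac{u_h-u}{h}-\delta u\Big\|_{L^\infty([T_0,T],H)}=0,$$ that is, the solution is Gâteaux differentiable with respect to the coefficients, with derivative $\delta u$. -/

import Mathlib

open MeasureTheory Filter Topology Set
open scoped ContDiff

namespace Evolution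

section Spaces

variable {H : Type*} [NormedAddCommGroup H] [InnerProductSpace ℝ H]

/-- Causality: `u` vanishes on some half-axis `(-∞, T)`, for almost every `t` there
(elements of `L²_loc` are classes of functions modulo null sets; for a continuous function this
is the same as vanishing everywhere on `(-∞, T)`). -/
def IsCausal (u : ℝ → H) : Prop :=
  ∃ T : ℝ, ∀ᵐ t : ℝ, t < T → u t = 0

/-- The space `L²_+(ℝ, H)` of functions that are square integrable on every half-axis
`(-∞, T]`. -/
def MemL2Plus (u : ℝ → H) : Prop :=
  ∀ T : ℝ, MemLp u 2 (volume.restrict (Iic T))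

/-- `g` is the weak derivative of `f` on the real line. -/
def IsWeakDeriv (f g : ℝ → H) : Prop :=
  ∀ η : ℝ → ℝ, ContDiff ℝ ∞ η → HasCompactSupport η →
    ∫ t, deriv η t • f t = -∫ t, η t • g t

/-- The Sobolev space `H¹(ℝ, H)`: square integrable functions with a square integrable weak
derivative. -/
def MemH1 (f : ℝ → H) : Prop :=
  MemLp f 2 volume ∧ ∃ g : ℝ → H, MemLp g 2 volume ∧ IsWeakDeriv f g

end Spaces

section Coefficients

variable {H : Type*} [NormedAddCommGroup H] [InnerProductSpace ℝ H] [CompleteSpace H]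

/-- The bounds `c I ≤ A ≤ C I`. -/
def OperatorBounds (c C : ℝ) (A : H →L[ℝ] H) : Prop :=
  ∀ x : H, c * ‖x‖ ^ 2 ≤ inner ℝ (A x) x ∧ inner ℝ (A x) x ≤ C * ‖x‖ ^ 2

/-- Causal memory kernels: `Q ∈ L¹(ℝ, B_symm(H)) ∩ C⁰(ℝ₊, B(H))` with `Q(t) = 0` for `t < 0`. -/
structure IsKernel (Q : ℝ → H →L[ℝ] H) : Prop where
  integrable : Integrable Q volume
  symm : ∀ t, IsSelfAdjoint (Q t)
  continuousOn : ContinuousOn Q (Ici 0)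
  causal : ∀ t < 0, Q t = 0

/-- The standing assumptions on the coefficients `A`, `Q` (the coefficient `B` is an arbitrary
bounded operator): `A` is bounded, self-adjoint and coercive, `Q` is a causal memory kernel. -/
structure IsCoefficient (A : H →L[ℝ] H) (Q : ℝ → H →L[ℝ] H) : Prop where
  symm : IsSelfAdjoint A
  bounds : ∃ c C : ℝ, 0 < c ∧ c ≤ C ∧ OperatorBounds c C A
  kernel : IsKernel Q

/-- The set `𝒫(C_*, C^*, C_B, C_Q)` of coefficient triples `(A, B, Q)`. -/
def coeffSet (H : Type*) [NormedAddCommGroup H] [InnerProductSpace ℝ H] [CompleteSpace H]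
    (cA CA CB CQ : ℝ) : Set ((H →L[ℝ] H) × (H →L[ℝ] H) × (ℝ → H →L[ℝ] H)) :=
  {p | IsSelfAdjoint p.1 ∧ OperatorBounds cA CA p.1 ∧ ‖p.2.1‖ ≤ CB ∧ IsKernel p.2.2 ∧
    eLpNorm p.2.2 1 volume + eLpNorm p.2.2 ⊤ volume ≤ ENNReal.ofReal CQ}

/-- The set `𝒫` of admissible coefficients: the union of all `𝒫(C_*, C^*, C_B, C_Q)`. -/
def admissible (H : Type*) [NormedAddCommGroup H] [InnerProductSpace ℝ H] [CompleteSpace H] :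
    Set ((H →L[ℝ] H) × (H →L[ℝ] H) × (ℝ → H →L[ℝ] H)) :=
  {p | ∃ cA CA CB CQ : ℝ, 0 < cA ∧ cA ≤ CA ∧ 0 ≤ CB ∧ 0 ≤ CQ ∧ p ∈ coeffSet H cA CA CB CQ}

/-- The memory operator `R[u](t) = ∫ Q(t - s) u(s) ds` with kernel `Q`. -/
noncomputable def memory (Q : ℝ → H →L[ℝ] H) (u : ℝ → H) (t : ℝ) : H :=
  ∫ s, Q (t - s) (u s)

/-- The formal adjoint `R^*[φ](t) = ∫ Q(s - t) φ(s) ds` of the memory operator. -/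
noncomputable def memoryAdj (Q : ℝ → H →L[ℝ] H) (φ : ℝ → H) (t : ℝ) : H :=
  ∫ s, Q (s - t) (φ s)

end Coefficients

section Problem

variable {H : Type*} [NormedAddCommGroup H] [InnerProductSpace ℝ H] [CompleteSpace H]
variable {V : Type*} [NormedAddCommGroup V] [InnerProductSpace ℝ V]

/-- `P` is a (densely defined) skew-adjoint operator in `H` whose domain, identified by `e` with
the normed space `V`, has a graph norm equivalent to the norm of `V`. -/
structure IsSpatialOperator (P : H →ₗ.[ℝ] H) (e : V ≃ₗ[ℝ] P.domain) : Prop where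
  dense : Dense (P.domain : Set H)
  skewAdjoint : P.adjoint = -P
  graphNorm : ∃ c C : ℝ, 0 < c ∧ ∀ v : V,
    c * ‖v‖ ≤ √(‖(e v : H)‖ ^ 2 + ‖P (e v)‖ ^ 2) ∧
      √(‖(e v : H)‖ ^ 2 + ‖P (e v)‖ ^ 2) ≤ C * ‖v‖

variable (P : H →ₗ.[ℝ] H) (e : V ≃ₗ[ℝ] P.domain)

/-- `u` is a weak solution of `A u' + P u + B u + R[u] = f`: it belongs to `L²_+(ℝ, H)` and
satisfies the equation tested against all `φ ∈ C_0^∞(ℝ, V)`. -/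
structure IsWeakSolution (A B : H →L[ℝ] H) (Q : ℝ → H →L[ℝ] H) (f u : ℝ → H) : Prop where
  memL2Plus : MemL2Plus u
  weak_eq : ∀ φ : ℝ → V, ContDiff ℝ ∞ φ → HasCompactSupport φ →
    ∫ t, inner ℝ (u t)
        (A (e (deriv φ t)) + P (e (φ t)) - B.adjoint (e (φ t))
          - memoryAdj Q (fun s => (e (φ s) : H)) t) =
      -∫ t, inner ℝ (f t) (e (φ t) : H)

/-- `u` is a strong solution of `A u' + P u + B u + R[u] = f`: it belongs to
`C¹(ℝ, H) ∩ C⁰(ℝ, V) ∩ L²_+(ℝ, H)` and satisfies the equation at every `t`. -/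
structure IsStrongSolution (A B : H →L[ℝ] H) (Q : ℝ → H →L[ℝ] H) (f u : ℝ → H) : Prop where
  contDiff : ContDiff ℝ 1 u
  memL2Plus : MemL2Plus u
  eqn : ∃ w : ℝ → V, Continuous w ∧ (∀ t, (e (w t) : H) = u t) ∧
    ∀ t, A (deriv u t) + P (e (w t)) + B (u t) + memory Q u t = f t

end Problem

end Evolution

/-! Everything rests on one energy estimate (`energy_estimate`, `evolSol_energy`). Pairing the
equation with `u` gives `½ d/dt ⟨A u, u⟩ = ⟨f - B u - R[u], u⟩`, since the skew-adjoint term drops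
out. The causal term `B u + R[u]` is absorbed by an exponential weight in time. Hence `sup ‖u‖` on a
half-axis is bounded by the `L¹` norm of `f`, with a constant depending only on the coercivity
constant, a bound for `‖B‖ + ‖Q‖_{L¹}` and the time interval. Uniqueness of strong solutions and
stability uniform in the coefficients follow.

Existence: `P` is replaced by its bounded Yosida approximations `P (1 + P/(n+1))⁻¹`, for which
Picard iteration works (`exists_evolSol_bounded`). For `C¹` data the time derivatives of the
approximate solutions are bounded, hence by the equation so are the Yosida terms, and the energy
estimate for differences gives a Cauchy sequence (`exists_mildSol`). The coefficients do not depend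
on time, so integration in time preserves the equation, and since the graph of `P` is closed the
primitive of a mild solution is strong (`MildSol.strongSol`). A causal `f ∈ H¹` is the primitive of
some `g ∈ L¹_loc`; approximating `g` in `L¹` and integrating once yields the strong solution
(`exists_strongSol`).

The linearized right-hand side `F` is only continuous. Its solution `δu` is the locally uniform
limit of strong solutions `y n` with data `k n → F` in `L¹` (`exists_strongSol_approx`), and the
weak formulation passes to the limit. Weak solutions are unique because mollification in time makes
them strong (`strongSol_convolution`).

Differentiability: `(u_h - u)/h` solves the perturbed problem with right-hand side exactly `F`.
Since `δu` need not have a time derivative, it is not compared directly; instead `y n` solves the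
perturbed problem with right-hand side `k n + h Z_n`. Uniform stability bounds the difference by `‖k
n - F‖_{L¹} + |h| ‖Z_n‖_{L¹}` up to a constant; `n` is fixed first, then `h → 0`
(`differenceQuotient_tendsto`). -/

set_option linter.unusedSectionVars false

namespace Evolution

/-! ### Continuous causal functions, their primitives and limits -/

section Causal

variable {H : Type*} [NormedAddCommGroup H] [InnerProductSpace ℝ H]

/-- Continuous functions vanishing on `(-∞, a]`. -/
structure ContCausal (a : ℝ) (u : ℝ → H) : Prop where
  cont : Continuous u
  vanish : ∀ t ≤ a, u t = 0

namespace ContCausal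

variable {a : ℝ} {u v : ℝ → H}

lemma zero : ContCausal a (fun _ => (0 : H)) := ⟨continuous_const, fun _ _ => rfl⟩

lemma add (hu : ContCausal a u) (hv : ContCausal a v) : ContCausal a (fun t => u t + v t) :=
  ⟨hu.cont.add hv.cont, fun t ht => by simp [hu.vanish t ht, hv.vanish t ht]⟩

lemma sub (hu : ContCausal a u) (hv : ContCausal a v) : ContCausal a (fun t => u t - v t) :=
  ⟨hu.cont.sub hv.cont, fun t ht => by simp [hu.vanish t ht, hv.vanish t ht]⟩

lemma smul (c : ℝ) (hu : ContCausal a u) : ContCausal a (fun t => c • u t) :=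
  ⟨hu.cont.const_smul c, fun t ht => by simp [hu.vanish t ht]⟩

lemma clm (L : H →L[ℝ] H) (hu : ContCausal a u) : ContCausal a (fun t => L (u t)) :=
  ⟨L.continuous.comp hu.cont, fun t ht => by simp [hu.vanish t ht]⟩

lemma mono {b : ℝ} (hba : b ≤ a) (hu : ContCausal a u) : ContCausal b u :=
  ⟨hu.cont, fun t ht => hu.vanish t (ht.trans hba)⟩

lemma exists_bound (hu : ContCausal a u) (T : ℝ) : ∃ S, 0 ≤ S ∧ ∀ s ≤ T, ‖u s‖ ≤ S := by
  obtain ⟨C, hC⟩ := (isCompact_Icc (a := a) (b := T)).exists_bound_of_continuousOn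
    hu.cont.continuousOn
  refine ⟨max C 0, le_max_right _ _, fun s hs => ?_⟩
  rcases le_total s a with h | h
  · simp [hu.vanish s h]
  · exact (hC s ⟨h, hs⟩).trans (le_max_left _ _)

lemma memL2Plus (hu : ContCausal a u) : MemL2Plus u := by
  intro T
  obtain ⟨S, hS0, hS⟩ := hu.exists_bound T
  have h1 : MemLp u 2 (volume.restrict (Icc a T)) := by
    refine MemLp.of_bound hu.cont.aestronglyMeasurable S ?_
    filter_upwards [ae_restrict_mem measurableSet_Icc] with t ht using hS t ht.2
  have h2 : MemLp ((Icc a T).indicator u) 2 (volume.restrict (Iic T)) := by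
    rw [memLp_indicator_iff_restrict measurableSet_Icc, Measure.restrict_restrict measurableSet_Icc,
      inter_eq_self_of_subset_left Icc_subset_Iic_self]
    exact h1
  refine (memLp_congr_ae ?_).1 h2
  filter_upwards [ae_restrict_mem measurableSet_Iic] with t ht
  by_cases hta : a ≤ t
  · rw [indicator_of_mem (show t ∈ Icc a T from ⟨hta, ht⟩)]
  · rw [indicator_of_notMem (fun h => hta h.1), hu.vanish t (not_le.1 hta).le]

lemma isCausal (hu : ContCausal a u) : IsCausal u :=
  ⟨a, Eventually.of_forall fun t ht => hu.vanish t ht.le⟩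

end ContCausal

lemma IsCausal.exists_contCausal {u : ℝ → H} (hu : IsCausal u) (hc : Continuous u) :
    ∃ a, ContCausal a u := by
  obtain ⟨T, hT⟩ := hu
  -- Vanishing is obtained on the open half-axis only; the shift by 1 gives a closed one.
  refine ⟨T - 1, hc, fun t ht => ?_⟩
  have h1 : u =ᵐ[volume.restrict (Iio T)] fun _ => 0 := by
    rw [EventuallyEq, ae_restrict_iff' measurableSet_Iio]
    filter_upwards [hT] with t ht using ht
  have := Measure.eqOn_open_of_ae_eq h1 isOpen_Iio hc.continuousOn continuousOn_const
  exact this (show t < T by linarith)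

/-- The primitive of `w` with base point `a`. -/
noncomputable def prim (a : ℝ) (w : ℝ → H) (t : ℝ) : H := ∫ s in a..t, w s

variable [CompleteSpace H] {a : ℝ}

lemma hasDerivAt_prim {w : ℝ → H} (hw : Continuous w) (t : ℝ) :
    HasDerivAt (prim a w) (w t) t :=
  (hw.integral_hasStrictDerivAt a t).hasDerivAt

lemma prim_vanish {w : ℝ → H} (hw : ∀ t ≤ a, w t = 0) (t : ℝ) (ht : t ≤ a) : prim a w t = 0 := by
  rw [prim, intervalIntegral.integral_symm, intervalIntegral.integral_of_le ht,
    setIntegral_eq_zero_of_forall_eq_zero (fun s hs => hw s hs.2), neg_zero]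

lemma ContCausal.prim {w : ℝ → H} (hw : ContCausal a w) : ContCausal a (prim a w) :=
  ⟨continuous_iff_continuousAt.2 fun t => (hasDerivAt_prim hw.cont t).continuousAt,
    prim_vanish hw.vanish⟩

lemma norm_prim_le {w : ℝ → H} {T : ℝ} (hw : ∀ t ≤ a, w t = 0)
    (hi : IntervalIntegrable w volume a T) (t : ℝ) (ht : t ≤ T) :
    ‖prim a w t‖ ≤ ∫ s in a..T, ‖w s‖ := by
  rcases le_total t a with h | h
  · rw [prim_vanish hw t h, norm_zero]
    rcases le_total a T with h' | h'
    · exact intervalIntegral.integral_nonneg h' fun _ _ => norm_nonneg _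
    · rw [intervalIntegral.integral_symm, intervalIntegral.integral_of_le h',
        setIntegral_eq_zero_of_forall_eq_zero (fun s hs => by simp [hw s hs.2]), neg_zero]
  · refine (intervalIntegral.norm_integral_le_integral_norm h).trans ?_
    exact intervalIntegral.integral_mono_interval le_rfl h ht
      (Eventually.of_forall fun _ => norm_nonneg _) hi.norm

/-- A locally uniform limit of continuous causal functions exists as soon as the sequence is
Cauchy uniformly on half-axes. -/
lemma exists_contCausal_limit {U : ℕ → ℝ → H} (hU : ∀ n, ContCausal a (U n))
    (hC : ∀ T, UniformCauchySeqOn U atTop (Iic T)) :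
    ∃ u, ContCausal a u ∧ ∀ T, TendstoUniformlyOn U u atTop (Iic T) := by
  have h1 : ∀ t, ∃ x, Tendsto (fun n => U n t) atTop (𝓝 x) := fun t =>
    cauchySeq_tendsto_of_complete ((hC t).cauchySeq self_mem_Iic)
  choose u hu using h1
  have h2 : ∀ T, TendstoUniformlyOn U u atTop (Iic T) := fun T =>
    (hC T).tendstoUniformlyOn_of_tendsto fun t _ => hu t
  refine ⟨u, ⟨?_, fun t ht => ?_⟩, h2⟩
  · rw [continuous_iff_continuousAt]
    intro t
    have := (h2 (t + 1)).continuousOn (Frequently.of_forall fun n => (hU n).cont.continuousOn)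
    exact this.continuousAt (Iic_mem_nhds (by linarith))
  · refine tendsto_nhds_unique (hu t) ?_
    simp [(hU _).vanish t ht]

lemma tendstoUniformlyOn_prim {W : ℕ → ℝ → H} {w : ℝ → H} (hW : ∀ n, ContCausal a (W n))
    (hw : ContCausal a w) (h : ∀ T, TendstoUniformlyOn W w atTop (Iic T)) (T : ℝ) :
    TendstoUniformlyOn (fun n => prim a (W n)) (prim a w) atTop (Iic T) := by
  rw [Metric.tendstoUniformlyOn_iff]
  intro ε hε
  have hpos : 0 < ε / (|T - a| + 1) := by positivity
  filter_upwards [Metric.tendstoUniformlyOn_iff.1 (h T) _ hpos] with n hn t ht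
  rcases le_total t a with h' | h'
  · rw [prim_vanish hw.vanish t h', prim_vanish (hW n).vanish t h', dist_self]
    exact hε
  rw [dist_eq_norm, prim, prim, ← intervalIntegral.integral_sub
    (hw.cont.intervalIntegrable _ _) ((hW n).cont.intervalIntegrable _ _)]
  have := intervalIntegral.norm_integral_le_of_norm_le_const (a := a) (b := t)
    (f := fun s => w s - W n s) (C := ε / (|T - a| + 1)) (fun s hs => by
      rw [uIoc_of_le h'] at hs
      rw [← dist_eq_norm]
      exact (hn s (hs.2.trans ht)).le)
  refine this.trans_lt ?_
  have h3 : |t - a| ≤ |T - a| := by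
    rw [abs_of_nonneg (by linarith), abs_of_nonneg (by linarith [show t ≤ T from ht])]
    linarith [show t ≤ T from ht]
  rw [div_mul_eq_mul_div, div_lt_iff₀ (by positivity)]
  nlinarith

end Causal

/-! ### The memory operator on continuous causal functions -/

section Memory

variable {H : Type*} [NormedAddCommGroup H] [InnerProductSpace ℝ H] [CompleteSpace H]
variable {Q : ℝ → H →L[ℝ] H} {a : ℝ}

/-- In this form `t` enters only through `u`, so regularity in time is inherited from `u` and
integrability of `Q` suffices. -/
lemma memory_eq (Q : ℝ → H →L[ℝ] H) (u : ℝ → H) (t : ℝ) :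
    memory Q u t = ∫ σ, Q σ (u (t - σ)) := by
  rw [memory, ← integral_sub_left_eq_self (fun σ => Q σ (u (t - σ))) volume t]
  simp

lemma IsKernel.norm_apply_le (hQ : IsKernel Q) {u : ℝ → H} {t S : ℝ} (hS : ∀ s ≤ t, ‖u s‖ ≤ S)
    (σ : ℝ) : ‖Q σ (u (t - σ))‖ ≤ ‖Q σ‖ * S := by
  rcases lt_or_ge σ 0 with h | h
  · simp [hQ.causal σ h]
  · exact (Q σ).le_opNorm_of_le (hS _ (by linarith))

lemma IsKernel.aestronglyMeasurable_apply (hQ : IsKernel Q) {u : ℝ → H} (hu : Continuous u)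
    (t : ℝ) : AEStronglyMeasurable (fun σ => Q σ (u (t - σ))) volume :=
  (ContinuousLinearMap.id ℝ (H →L[ℝ] H)).aestronglyMeasurable_comp₂
    hQ.integrable.aestronglyMeasurable
    (hu.comp (continuous_const.sub continuous_id)).aestronglyMeasurable

lemma IsKernel.integrable_apply (hQ : IsKernel Q) {u : ℝ → H} (hu : ContCausal a u) (t : ℝ) :
    Integrable (fun σ => Q σ (u (t - σ))) volume := by
  obtain ⟨S, -, hS⟩ := hu.exists_bound t
  exact (hQ.integrable.norm.mul_const S).mono' (hQ.aestronglyMeasurable_apply hu.cont t)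
    (Eventually.of_forall (hQ.norm_apply_le hS))

lemma IsKernel.norm_memory_le (hQ : IsKernel Q) {u : ℝ → H} {t S : ℝ}
    (hS : ∀ s ≤ t, ‖u s‖ ≤ S) : ‖memory Q u t‖ ≤ (∫ σ, ‖Q σ‖) * S := by
  rw [memory_eq, ← integral_mul_const]
  exact norm_integral_le_of_norm_le (hQ.integrable.norm.mul_const S)
    (Eventually.of_forall (hQ.norm_apply_le hS))

lemma IsKernel.contCausal_memory (hQ : IsKernel Q) {u : ℝ → H} (hu : ContCausal a u) :
    ContCausal a (memory Q u) := by
  refine ⟨?_, fun t ht => ?_⟩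
  · rw [continuous_iff_continuousAt]
    intro t₀
    obtain ⟨S, -, hS⟩ := hu.exists_bound (t₀ + 1)
    have : memory Q u = fun t => ∫ σ, Q σ (u (t - σ)) := funext (memory_eq Q u)
    rw [this]
    refine continuousAt_of_dominated (bound := fun σ => ‖Q σ‖ * S)
      (Eventually.of_forall fun t => hQ.aestronglyMeasurable_apply hu.cont t) ?_
      (hQ.integrable.norm.mul_const S) (Eventually.of_forall fun σ => ?_)
    · filter_upwards [Iic_mem_nhds (show t₀ < t₀ + 1 by linarith)] with t ht
      exact Eventually.of_forall (hQ.norm_apply_le fun s hs => hS s (hs.trans ht))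
    · exact ((Q σ).continuous.comp (hu.cont.comp (continuous_id.sub continuous_const))).continuousAt
  · have := hQ.norm_memory_le (u := u) (t := t) (S := 0)
      (fun s hs => by simp [hu.vanish s (hs.trans ht)])
    simpa using this

/-- Translation invariance in time lets the derivative fall on `u`; dominated convergence applies
because `w` is bounded on half-axes. This is why the equation can be integrated in time. -/
lemma IsKernel.hasDerivAt_memory (hQ : IsKernel Q) {u w : ℝ → H} (hu : ContCausal a u)
    (hw : ContCausal a w) (hd : ∀ t, HasDerivAt u (w t) t) (t₀ : ℝ) :
    HasDerivAt (memory Q u) (memory Q w t₀) t₀ := by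
  obtain ⟨S, -, hS⟩ := hw.exists_bound (t₀ + 1)
  have : memory Q u = fun t => ∫ σ, Q σ (u (t - σ)) := funext (memory_eq Q u)
  rw [this, memory_eq]
  refine (hasDerivAt_integral_of_dominated_loc_of_deriv_le (bound := fun σ => ‖Q σ‖ * S)
    (F := fun t σ => Q σ (u (t - σ))) (F' := fun t σ => Q σ (w (t - σ)))
    (Iic_mem_nhds (show t₀ < t₀ + 1 by linarith))
    (Eventually.of_forall fun t => hQ.aestronglyMeasurable_apply hu.cont t)
    (hQ.integrable_apply hu t₀) (hQ.aestronglyMeasurable_apply hw.cont t₀)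
    (Eventually.of_forall fun σ t ht => hQ.norm_apply_le (fun s hs => hS s (hs.trans ht)) σ)
    (hQ.integrable.norm.mul_const S) (Eventually.of_forall fun σ t _ => ?_)).2
  exact (Q σ).hasFDerivAt.comp_hasDerivAt t ((hd (t - σ)).comp_sub_const t σ)

lemma IsKernel.memory_sub (hQ : IsKernel Q) {u v : ℝ → H} (hu : ContCausal a u)
    (hv : ContCausal a v) (t : ℝ) :
    memory Q (fun s => u s - v s) t = memory Q u t - memory Q v t := by
  simp only [memory_eq, map_sub]
  exact integral_sub (hQ.integrable_apply hu t) (hQ.integrable_apply hv t)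

lemma memory_smul (Q : ℝ → H →L[ℝ] H) (c : ℝ) (u : ℝ → H) (t : ℝ) :
    memory Q (fun s => c • u s) t = c • memory Q u t := by
  simp only [memory, map_smul]
  exact integral_smul c _

lemma memory_add_smul_kernel {δQ : ℝ → H →L[ℝ] H} (hQ : IsKernel Q) (hδQ : IsKernel δQ) (h : ℝ)
    {u : ℝ → H} (hu : ContCausal a u) (t : ℝ) :
    memory (fun s => Q s + h • δQ s) u t = memory Q u t + h • memory δQ u t := by
  have h1 : Integrable (fun σ => h • δQ σ (u (t - σ))) volume := (hδQ.integrable_apply hu t).smul h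
  rw [memory_eq, memory_eq, memory_eq, ← integral_smul, ← integral_add (hQ.integrable_apply hu t) h1]
  rfl

end Memory

/-! ### The weighted energy estimate -/

section Energy

variable {H : Type*} [NormedAddCommGroup H] [InnerProductSpace ℝ H] [CompleteSpace H]

lemma hasDerivAt_energy {A : H →L[ℝ] H} (hA : IsSelfAdjoint A) {u : ℝ → H} {u' : H} {t : ℝ}
    (hu : HasDerivAt u u' t) :
    HasDerivAt (fun t => inner ℝ (A (u t)) (u t)) (2 * inner ℝ (A u') (u t)) t := by
  have h := (A.hasFDerivAt.comp_hasDerivAt t hu).inner ℝ hu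
  convert! h using 1
  have h1 : inner ℝ (A (u t)) u' = inner ℝ (u t) (A u') := hA.isSymmetric (u t) u'
  rw [Function.comp_apply, h1, real_inner_comm]
  ring

/-- The energy estimate for `A u' + p + r = f` where `p` is almost accretive and `r` is a causal
perturbation of order zero. -/
theorem energy_estimate {c a T : ℝ} (q : ℝ) (hc : 0 < c) (haT : a ≤ T) :
    ∃ K, 0 < K ∧ ∀ A : H →L[ℝ] H, IsSelfAdjoint A → (∀ x, c * ‖x‖ ^ 2 ≤ inner ℝ (A x) x) →
      ∀ (u u' p r f : ℝ → H) (ε : ℝ), 0 ≤ ε → (∀ t, HasDerivAt u (u' t) t) →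
      (∀ t ≤ a, u t = 0) → (∀ t, A (u' t) + p t + r t = f t) →
      (∀ t ≤ T, -ε ≤ inner ℝ (p t) (u t)) →
      (∀ t S, (∀ s ≤ t, ‖u s‖ ≤ S) → ‖r t‖ ≤ q * S) → Continuous f →
      ∀ t ≤ T, ‖u t‖ ^ 2 ≤ K * (ε + (∫ s in a..T, ‖f s‖) ^ 2) := by
  set l := T - a with hl
  have hl0 : 0 ≤ l := by linarith
  -- The decay rate of the weight is chosen so that the contribution `D * l` of the lower-order term
  -- is at most `c * N ^ 2 / 4` and can be absorbed.
  obtain ⟨γ, hγ0, hγ⟩ : ∃ γ : ℝ, 0 < γ ∧ q ^ 2 * l ≤ γ * c ^ 2 / 2 := by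
    refine ⟨2 * q ^ 2 * l / c ^ 2 + 1, by positivity, ?_⟩
    have : (2 * q ^ 2 * l / c ^ 2 + 1) * c ^ 2 = 2 * q ^ 2 * l + c ^ 2 := by field_simp
    rw [this]
    nlinarith [sq_nonneg c]
  refine ⟨Real.exp (γ * l) ^ 2 * (4 * l / c + 8 / c ^ 2 + 1), by positivity, ?_⟩
  intro A hA hcA u u' p r f ε hε hu hu0 heq hp hr hf
  have huc : Continuous u := continuous_iff_continuousAt.2 fun t => (hu t).continuousAt
  let w : ℝ → ℝ := fun t => Real.exp (-γ * (t - a))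
  have hw0 : ∀ t, 0 < w t := fun t => Real.exp_pos _
  have hwd : ∀ t, HasDerivAt w (-γ * w t) t := by
    intro t
    have h1 : HasDerivAt (fun t => -γ * (t - a)) (-γ * 1) t :=
      ((hasDerivAt_id t).sub_const a).const_mul (-γ)
    have h2 := h1.exp
    convert! h2 using 1
    simp only [w]
    ring
  have hwc : Continuous w := continuous_iff_continuousAt.2 fun t => (hwd t).continuousAt
  -- The energy inequality is integrated only up to the point `t₁` where the weighted norm is
  -- maximal; there the energy dominates `c * N ^ 2`.
  obtain ⟨t₁, ht₁, hmax⟩ := (isCompact_Icc (a := a) (b := T)).exists_isMaxOn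
    (nonempty_Icc.2 haT) (hwc.mul huc.norm).continuousOn
  set N := w t₁ * ‖u t₁‖ with hN
  have hN0 : 0 ≤ N := by have := hw0 t₁; positivity
  have hNt : ∀ t ≤ T, w t * ‖u t‖ ≤ N := by
    intro t ht
    rcases le_total t a with h | h
    · simpa [hu0 t h] using hN0
    · exact hmax (show t ∈ Icc a T from ⟨h, ht⟩)
  -- As `w` decreases, past values of `u` are at most `N / w t`, so a causal term is controlled by
  -- the same maximum `N`.
  have hrN : ∀ t ≤ T, w t * ‖r t‖ ≤ q * N := by
    intro t ht
    have h1 : ∀ s ≤ t, ‖u s‖ ≤ N / w t := by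
      intro s hs
      rw [le_div_iff₀ (hw0 t)]
      have h2 : w t ≤ w s := by
        simp only [w]
        exact Real.exp_le_exp.2 (by nlinarith)
      calc ‖u s‖ * w t ≤ ‖u s‖ * w s := by gcongr
        _ = w s * ‖u s‖ := mul_comm _ _
        _ ≤ N := hNt s (hs.trans ht)
    have h3 := hr t _ h1
    calc w t * ‖r t‖ ≤ w t * (q * (N / w t)) := by have := (hw0 t).le; gcongr
      _ = q * N := by field_simp [(hw0 t).ne']
  -- The maximum over `y` of `2 q N y - 2 γ c y ^ 2`, the lower-order term against the damping
  -- produced by the weight.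
  set D := q ^ 2 * N ^ 2 / (2 * γ * c) with hD
  have hD0 : 0 ≤ D := by positivity
  set Φ := ∫ s in a..T, ‖f s‖ with hΦ
  have hΦ0 : 0 ≤ Φ := intervalIntegral.integral_nonneg haT fun _ _ => norm_nonneg _
  let ψ : ℝ → ℝ := fun t => w t * w t * inner ℝ (A (u t)) (u t)
  have hψd : ∀ t, HasDerivAt ψ ((-γ * w t * w t + w t * (-γ * w t)) * inner ℝ (A (u t)) (u t) +
      w t * w t * (2 * inner ℝ (A (u' t)) (u t))) t := fun t =>
    ((hwd t).mul (hwd t)).mul (hasDerivAt_energy hA (hu t))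
  have hψle : ∀ t ∈ Icc a T, (-γ * w t * w t + w t * (-γ * w t)) * inner ℝ (A (u t)) (u t) +
      w t * w t * (2 * inner ℝ (A (u' t)) (u t)) ≤ 2 * N * ‖f t‖ + (2 * ε + D) := by
    intro t ht
    have hw := hw0 t
    have hw1 : w t ≤ 1 := Real.exp_le_one_iff.2 (by nlinarith [ht.1])
    set y := w t * ‖u t‖ with hy
    have hy0 : 0 ≤ y := by positivity
    have hyN : y ≤ N := hNt t ht.2
    have h1 : inner ℝ (A (u' t)) (u t) ≤ ‖f t‖ * ‖u t‖ + ‖r t‖ * ‖u t‖ + ε := by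
      have : A (u' t) = f t - p t - r t := by rw [← heq t]; abel
      rw [this, inner_sub_left, inner_sub_left]
      have e1 := real_inner_le_norm (f t) (u t)
      have e2 := (abs_le.1 (abs_real_inner_le_norm (r t) (u t))).1
      have e3 := hp t ht.2
      linarith
    have h2 : c * y ^ 2 ≤ w t * w t * inner ℝ (A (u t)) (u t) := by
      have := mul_le_mul_of_nonneg_left (hcA (u t)) (mul_pos hw hw).le
      calc c * y ^ 2 = w t * w t * (c * ‖u t‖ ^ 2) := by rw [hy]; ring
        _ ≤ _ := this
    have h3 : w t * w t * inner ℝ (A (u' t)) (u t) ≤ ‖f t‖ * N + q * N * y + ε := by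
      have e1 : w t * w t * (‖f t‖ * ‖u t‖) ≤ ‖f t‖ * N := by
        calc w t * w t * (‖f t‖ * ‖u t‖) = w t * (‖f t‖ * y) := by rw [hy]; ring
          _ ≤ 1 * (‖f t‖ * N) := by gcongr
          _ = _ := one_mul _
      have e2 : w t * w t * (‖r t‖ * ‖u t‖) ≤ q * N * y := by
        calc w t * w t * (‖r t‖ * ‖u t‖) = (w t * ‖r t‖) * y := by rw [hy]; ring
          _ ≤ q * N * y := mul_le_mul_of_nonneg_right (hrN t ht.2) hy0
      have e3 : w t * w t * ε ≤ ε := by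
        calc w t * w t * ε ≤ 1 * 1 * ε := by gcongr
          _ = ε := by ring
      have := mul_le_mul_of_nonneg_left h1 (mul_pos hw hw).le
      nlinarith
    have h4 : 2 * (q * N * y) - 2 * γ * c * y ^ 2 ≤ D := by
      rw [hD, le_div_iff₀ (by positivity)]
      nlinarith [sq_nonneg (q * N - 2 * γ * c * y)]
    nlinarith
  have hψt : ψ t₁ ≤ 2 * N * (∫ s in a..t₁, ‖f s‖) + (2 * ε + D) * (t₁ - a) := by
    have hFd : ∀ t, HasDerivAt (fun t => 2 * N * (∫ s in a..t, ‖f s‖) + (2 * ε + D) * (t - a))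
        (2 * N * ‖f t‖ + (2 * ε + D)) t := by
      intro t
      have h1 := (hf.norm.integral_hasStrictDerivAt a t).hasDerivAt.const_mul (2 * N)
      have h2 := ((hasDerivAt_id t).sub_const a).const_mul (2 * ε + D)
      rw [mul_one] at h2
      exact h1.add h2
    refine image_le_of_deriv_right_le_deriv_boundary (a := a) (b := T)
      (fun t _ => (hψd t).continuousAt.continuousWithinAt) (fun t _ => (hψd t).hasDerivWithinAt) ?_
      (fun t _ => (hFd t).continuousAt.continuousWithinAt) (fun t _ => (hFd t).hasDerivWithinAt)
      (fun t ht => hψle t ⟨ht.1, ht.2.le⟩) ht₁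
    simp [ψ, hu0 a le_rfl]
  have hint : (∫ s in a..t₁, ‖f s‖) ≤ Φ :=
    intervalIntegral.integral_mono_interval le_rfl ht₁.1 ht₁.2
      (Eventually.of_forall fun _ => norm_nonneg _) (hf.norm.intervalIntegrable _ _)
  have hmain : c * N ^ 2 ≤ 2 * N * Φ + (2 * ε + D) * l := by
    have h2 : c * N ^ 2 ≤ ψ t₁ := by
      have := mul_le_mul_of_nonneg_left (hcA (u t₁)) (mul_pos (hw0 t₁) (hw0 t₁)).le
      calc c * N ^ 2 = w t₁ * w t₁ * (c * ‖u t₁‖ ^ 2) := by rw [hN]; ring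
        _ ≤ _ := this
    have h3 : t₁ - a ≤ l := by linarith [ht₁.2]
    calc c * N ^ 2 ≤ _ := h2.trans hψt
      _ ≤ 2 * N * Φ + (2 * ε + D) * l := by gcongr
  have hDl : D * l ≤ c * N ^ 2 / 4 := by
    rw [hD, div_mul_eq_mul_div, div_le_iff₀ (by positivity)]
    nlinarith [mul_le_mul_of_nonneg_right hγ (sq_nonneg N)]
  have hN2 : N ^ 2 ≤ (4 * l / c + 8 / c ^ 2 + 1) * (ε + Φ ^ 2) := by
    -- Young's inequality `2 c N Φ ≤ c² N² / 4 + 4 Φ²`; together with `hDl` it leaves half of `c²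
    -- N²` on the left.
    have h1 : c ^ 2 * N ^ 2 ≤ 4 * l * c * ε + 8 * Φ ^ 2 := by
      nlinarith [sq_nonneg (c * N - 4 * Φ)]
    have h2 : N ^ 2 ≤ 4 * l / c * ε + 8 / c ^ 2 * Φ ^ 2 := by
      have : 4 * l / c * ε + 8 / c ^ 2 * Φ ^ 2 = (4 * l * c * ε + 8 * Φ ^ 2) / c ^ 2 := by
        field_simp
      rw [this, le_div_iff₀ (by positivity)]
      linarith
    have h3 : 0 ≤ 4 * l / c := by positivity
    have h4 : 0 ≤ 8 / c ^ 2 := by positivity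
    nlinarith [sq_nonneg Φ, mul_nonneg h3 (sq_nonneg Φ), mul_nonneg h4 hε]
  intro t ht
  rcases le_total t a with h | h
  · rw [hu0 t h]
    have h1 : 0 ≤ ε + Φ ^ 2 := by positivity
    have h2 : 0 ≤ 4 * l / c + 8 / c ^ 2 + 1 := by positivity
    have := mul_nonneg (mul_nonneg (sq_nonneg (Real.exp (γ * l))) h2) h1
    simpa using this
  have h1 : ‖u t‖ ≤ Real.exp (γ * l) * N := by
    have h2 : ‖u t‖ = Real.exp (γ * (t - a)) * (w t * ‖u t‖) := by
      simp only [w]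
      rw [← mul_assoc, ← Real.exp_add]
      simp
    rw [h2]
    refine mul_le_mul (Real.exp_le_exp.2 ?_) (hNt t ht) ?_ (Real.exp_pos _).le
    · exact mul_le_mul_of_nonneg_left (by linarith) hγ0.le
    · exact mul_nonneg (hw0 t).le (norm_nonneg _)
  calc ‖u t‖ ^ 2 ≤ (Real.exp (γ * l) * N) ^ 2 := by gcongr
    _ = Real.exp (γ * l) ^ 2 * N ^ 2 := by ring
    _ ≤ Real.exp (γ * l) ^ 2 * ((4 * l / c + 8 / c ^ 2 + 1) * (ε + Φ ^ 2)) := by gcongr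
    _ = _ := by ring

end Energy

/-! ### Abstract evolution equations and the case of bounded operators -/

section Solutions

variable {H : Type*} [NormedAddCommGroup H] [InnerProductSpace ℝ H] [CompleteSpace H]

/-- Quantitative assumptions on the coefficients, under which the energy estimate is uniform. -/
structure CoeffBound (c q : ℝ) (A B : H →L[ℝ] H) (Q : ℝ → H →L[ℝ] H) : Prop where
  pos : 0 < c
  symm : IsSelfAdjoint A
  coercive : ∀ x, c * ‖x‖ ^ 2 ≤ inner ℝ (A x) x
  kernel : IsKernel Q
  bound : ‖B‖ + ∫ σ, ‖Q σ‖ ≤ q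

/-- `u` is a continuously differentiable solution, with derivative `u'`, of
`A u' + p + B u + R[u] = f` vanishing on `(-∞, a]`. -/
structure EvolSol (A B : H →L[ℝ] H) (Q : ℝ → H →L[ℝ] H) (a : ℝ) (p f u u' : ℝ → H) : Prop where
  cont : Continuous u'
  vanish : ∀ t ≤ a, u t = 0
  deriv : ∀ t, HasDerivAt u (u' t) t
  eqn : ∀ t, A (u' t) + p t + B (u t) + memory Q u t = f t

variable {A B : H →L[ℝ] H} {Q : ℝ → H →L[ℝ] H} {a c q : ℝ} {p f u u' : ℝ → H}

lemma CoeffBound.norm_lower_order_le (hC : CoeffBound c q A B Q) {t S : ℝ}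
    (hS : ∀ s ≤ t, ‖u s‖ ≤ S) : ‖B (u t) + memory Q u t‖ ≤ q * S := by
  have hS0 : 0 ≤ S := (norm_nonneg _).trans (hS t le_rfl)
  calc ‖B (u t) + memory Q u t‖ ≤ ‖B‖ * S + (∫ σ, ‖Q σ‖) * S :=
        norm_add_le_of_le (B.le_opNorm_of_le (hS t le_rfl)) (hC.kernel.norm_memory_le hS)
    _ = (‖B‖ + ∫ σ, ‖Q σ‖) * S := by ring
    _ ≤ q * S := by gcongr; exact hC.bound

lemma EvolSol.contCausal (h : EvolSol A B Q a p f u u') : ContCausal a u :=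
  ⟨continuous_iff_continuousAt.2 fun t => (h.deriv t).continuousAt, h.vanish⟩

lemma EvolSol.deriv_contCausal (h : EvolSol A B Q a p f u u') : ContCausal a u' := by
  have h1 : ∀ t < a, u' t = 0 := by
    intro t ht
    refine (h.deriv t).unique ((hasDerivAt_const t (0 : H)).congr_of_eventuallyEq ?_)
    filter_upwards [Iio_mem_nhds ht] with s hs using h.vanish s hs.le
  refine ⟨h.cont, fun t ht => ?_⟩
  rcases ht.lt_or_eq with h2 | rfl
  · exact h1 t h2
  · have h3 : Tendsto u' (𝓝[<] t) (𝓝 (u' t)) := h.cont.continuousWithinAt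
    refine tendsto_nhds_unique h3 (tendsto_const_nhds.congr' ?_)
    filter_upwards [self_mem_nhdsWithin] with s hs using (h1 s hs).symm

lemma EvolSol.sub (hQ : IsKernel Q) {p₂ f₂ u₂ u₂' : ℝ → H} (h : EvolSol A B Q a p f u u')
    (h₂ : EvolSol A B Q a p₂ f₂ u₂ u₂') :
    EvolSol A B Q a (fun t => p t - p₂ t) (fun t => f t - f₂ t) (fun t => u t - u₂ t)
      (fun t => u' t - u₂' t) where
  cont := h.cont.sub h₂.cont
  vanish t ht := by simp [h.vanish t ht, h₂.vanish t ht]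
  deriv t := (h.deriv t).sub (h₂.deriv t)
  eqn t := by
    rw [hQ.memory_sub h.contCausal h₂.contCausal, ← h.eqn, ← h₂.eqn, map_sub, map_sub]
    abel

/-- Integrating in time maps solutions to solutions. -/
lemma EvolSol.integrate (hQ : IsKernel Q) (hp : Continuous p) (hf : Continuous f)
    (h : EvolSol A B Q a p f u u') :
    EvolSol A B Q a (prim a p) (prim a f) (prim a u) u where
  cont := h.contCausal.cont
  vanish := h.contCausal.prim.vanish
  deriv := hasDerivAt_prim h.contCausal.cont
  eqn := by
    have hu := h.contCausal
    -- The residual of the integrated equation: its derivative is the residual of the original one,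
    -- hence zero, and it vanishes at `a`.
    let z : ℝ → H := fun t =>
      A (u t) + prim a p t + B (prim a u t) + memory Q (prim a u) t - prim a f t
    have hz : ∀ t, HasDerivAt z 0 t := by
      intro t
      have := (((A.hasFDerivAt.comp_hasDerivAt t (h.deriv t)).add (hasDerivAt_prim (a := a) hp t)).add
        (B.hasFDerivAt.comp_hasDerivAt t (hasDerivAt_prim (a := a) hu.cont t))).add
        (hQ.hasDerivAt_memory hu.prim hu (hasDerivAt_prim hu.cont) t) |>.sub (hasDerivAt_prim (a := a) hf t)
      rw [h.eqn t, sub_self] at this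
      exact this
    intro t
    have h1 : z t = z a := is_const_of_deriv_eq_zero (fun t => (hz t).differentiableAt)
      (fun t => (hz t).deriv) t a
    have h2 : z a = 0 := by
      have h3 := (hQ.contCausal_memory hu.prim).vanish a le_rfl
      simp only [z, h3, h.vanish a le_rfl]
      simp [prim]
    exact sub_eq_zero.1 (h1.trans h2)

/-- The energy estimate, uniformly in the coefficients. -/
theorem evolSol_energy {c a T : ℝ} (q : ℝ) (hc : 0 < c) (haT : a ≤ T) :
    ∃ K, 0 < K ∧ ∀ (A B : H →L[ℝ] H) (Q : ℝ → H →L[ℝ] H), CoeffBound c q A B Q →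
      ∀ (p f u u' : ℝ → H) (ε : ℝ), EvolSol A B Q a p f u u' → 0 ≤ ε →
      (∀ t ≤ T, -ε ≤ inner ℝ (p t) (u t)) → Continuous f →
      ∀ t ≤ T, ‖u t‖ ^ 2 ≤ K * (ε + (∫ s in a..T, ‖f s‖) ^ 2) := by
  obtain ⟨K, hK, h⟩ := energy_estimate (H := H) q hc haT
  refine ⟨K, hK, fun A B Q hC p f u u' ε hu hε hp hf => ?_⟩
  refine h A hC.symm hC.coercive u u' p (fun t => B (u t) + memory Q u t) f ε hε hu.deriv hu.vanish
    (fun t => ?_) hp (fun t S hS => hC.norm_lower_order_le hS) hf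
  rw [← hu.eqn t]
  abel

/-- Lax–Milgram for the bilinear form `⟨A x, y⟩`. -/
lemma exists_rightInverse_of_coercive (hc : 0 < c) (hA : ∀ x, c * ‖x‖ ^ 2 ≤ inner ℝ (A x) x) :
    ∃ Ai : H →L[ℝ] H, ∀ x, A (Ai x) = x := by
  have hco : IsCoercive ((innerSL ℝ).comp A) :=
    ⟨c, hc, fun x => by simpa [pow_two, mul_assoc] using hA x⟩
  have h1 : ∀ x, hco.continuousLinearEquivOfBilin x = A x := fun x =>
    ext_inner_right ℝ fun w => by simp
  exact ⟨hco.continuousLinearEquivOfBilin.symm, fun x => by rw [← h1]; simp⟩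

/-- Solvability of the evolution problem with memory and bounded operators, by Picard iteration. -/
theorem exists_evolSol_bounded (hC : CoeffBound c q A B Q) (hf : ContCausal a f) :
    ∃ u u', EvolSol A B Q a (fun _ => 0) f u u' := by
  obtain ⟨Ai, hAi⟩ := exists_rightInverse_of_coercive hC.pos hC.coercive
  let G : (ℝ → H) → ℝ → H := fun u t => Ai (f t - (B (u t) + memory Q u t))
  have hG : ∀ u, ContCausal a u → ContCausal a (G u) := fun u hu =>
    (hf.sub ((hu.clm B).add (hC.kernel.contCausal_memory hu))).clm Ai
  have hq : 0 ≤ q := le_trans (by positivity) hC.bound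
  set L := ‖Ai‖ * q with hL
  have hL0 : 0 ≤ L := by positivity
  have hGsub : ∀ u v, ContCausal a u → ContCausal a v → ∀ t S, (∀ s ≤ t, ‖u s - v s‖ ≤ S) →
      ‖G u t - G v t‖ ≤ L * S := by
    intro u v hu hv t S hS
    have h1 : G u t - G v t =
        Ai (-(B (u t - v t) + memory Q (fun s => u s - v s) t)) := by
      rw [hC.kernel.memory_sub hu hv]
      simp only [G]
      rw [← map_sub, map_sub B]
      congr 1
      abel
    rw [h1, hL, mul_assoc]
    refine Ai.le_opNorm_of_le ?_
    rw [norm_neg]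
    exact hC.norm_lower_order_le (u := fun s => u s - v s) hS
  obtain ⟨U, hU0, hUs⟩ : ∃ U : ℕ → ℝ → H, U 0 = (fun _ => 0) ∧ ∀ n, U (n + 1) = prim a (G (U n)) :=
    ⟨fun n => Nat.rec (fun _ => 0) (fun _ v => prim a (G v)) n, rfl, fun _ => rfl⟩
  have hU : ∀ n, ContCausal a (U n) := by
    intro n
    induction n with
    | zero => rw [hU0]; exact ContCausal.zero
    | succ n ih => rw [hUs]; exact (hG _ ih).prim
  have hUd : ∀ n s, HasDerivAt (U (n + 1)) (G (U n) s) s := fun n s => by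
    rw [hUs]
    exact hasDerivAt_prim (hG _ (hU n)).cont s
  -- Integrating `L * exp (2 L (t - a))` gains a factor `1/2`, so in this weight the Picard map
  -- halves distances, whatever the length of the time interval.
  have hdiff : ∀ T, ∃ M, 0 ≤ M ∧ ∀ n, ∀ t ≤ T,
      ‖U (n + 1) t - U n t‖ ≤ M * (1 / 2) ^ n * Real.exp (2 * L * (t - a)) := by
    intro T
    obtain ⟨M, hM0, hM⟩ := (hU 1).exists_bound T
    refine ⟨M, hM0, fun n => ?_⟩
    have hvan : ∀ n, ∀ t ≤ a, ‖U (n + 1) t - U n t‖ ≤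
        M * (1 / 2) ^ n * Real.exp (2 * L * (t - a)) := by
      intro n t ht
      rw [(hU n).vanish t ht, (hU (n + 1)).vanish t ht, sub_zero, norm_zero]
      positivity
    induction n with
    | zero =>
      intro t ht
      rcases le_total t a with h | h
      · exact hvan 0 t h
      · have h1 : 1 ≤ Real.exp (2 * L * (t - a)) :=
          Real.one_le_exp (mul_nonneg (by positivity) (by linarith))
        have h2 : U 0 t = 0 := by rw [hU0]
        rw [h2, sub_zero, pow_zero, mul_one]
        calc ‖U (0 + 1) t‖ ≤ M * 1 := by rw [mul_one]; exact hM t ht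
          _ ≤ _ := by gcongr
    | succ n ih =>
      intro t ht
      rcases le_total t a with h | h
      · exact hvan (n + 1) t h
      have hd : ∀ s, HasDerivAt (fun s => U (n + 1 + 1) s - U (n + 1) s)
          (G (U (n + 1)) s - G (U n) s) s := fun s =>
        (hUd (n + 1) s).sub (hUd n s)
      have he : ∀ s, HasDerivAt (fun s => M * (1 / 2) ^ (n + 1) * Real.exp (2 * L * (s - a)))
          (L * (M * (1 / 2) ^ n * Real.exp (2 * L * (s - a)))) s := by
        intro s
        have h1 := ((((hasDerivAt_id s).sub_const a).const_mul (2 * L)).exp).const_mul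
          (M * (1 / 2) ^ (n + 1))
        convert! h1 using 1
        simp only [id]
        ring
      refine image_norm_le_of_norm_deriv_right_le_deriv_boundary (a := a) (b := T)
        (f := fun s => U (n + 1 + 1) s - U (n + 1) s)
        (fun s _ => (hd s).continuousAt.continuousWithinAt) (fun s _ => (hd s).hasDerivWithinAt)
        (hvan (n + 1) a le_rfl)
        he (fun s hs => hGsub _ _ (hU _) (hU _) s _ fun r hr => ?_) ⟨h, ht⟩
      refine (ih r (hr.trans hs.2.le)).trans ?_
      have : Real.exp (2 * L * (r - a)) ≤ Real.exp (2 * L * (s - a)) :=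
        Real.exp_le_exp.2 (mul_le_mul_of_nonneg_left (by linarith) (by positivity))
      gcongr
  have hgeo : ∀ T, ∃ M, 0 ≤ M ∧ ∀ t ≤ T, ∀ n, dist (U n t) (U (n + 1) t) ≤ M * (1 / 2) ^ n := by
    intro T
    obtain ⟨M, hM0, hM⟩ := hdiff T
    refine ⟨M * Real.exp (2 * L * (T - a)), by positivity, fun t ht n => ?_⟩
    rw [dist_comm, dist_eq_norm]
    have h1 : Real.exp (2 * L * (t - a)) ≤ Real.exp (2 * L * (T - a)) :=
      Real.exp_le_exp.2 (mul_le_mul_of_nonneg_left (by linarith) (by positivity))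
    calc _ ≤ M * (1 / 2) ^ n * Real.exp (2 * L * (t - a)) := hM n t ht
      _ ≤ M * (1 / 2) ^ n * Real.exp (2 * L * (T - a)) := by gcongr
      _ = _ := by ring
  have hCauchy : ∀ T, UniformCauchySeqOn U atTop (Iic T) := by
    intro T
    obtain ⟨M, hM0, hM⟩ := hgeo T
    have hlim : ∀ t ≤ T, ∃ x, Tendsto (fun n => U n t) atTop (𝓝 x) := fun t ht =>
      cauchySeq_tendsto_of_complete (cauchySeq_of_le_geometric _ _ (by norm_num) (hM t ht))
    choose! v hv using hlim
    refine TendstoUniformlyOn.uniformCauchySeqOn (f := v) ?_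
    rw [Metric.tendstoUniformlyOn_iff]
    intro ε hε
    have h1 : Tendsto (fun n : ℕ => M * (1 / 2 : ℝ) ^ n / (1 - 1 / 2)) atTop
        (𝓝 (M * 0 / (1 - 1 / 2))) :=
      ((tendsto_pow_atTop_nhds_zero_of_lt_one (by norm_num) (by norm_num)).const_mul M).div_const _
    rw [mul_zero, zero_div] at h1
    filter_upwards [h1.eventually (gt_mem_nhds hε)] with n hn t ht
    rw [dist_comm]
    exact (dist_le_of_le_geometric_of_tendsto _ _ (by norm_num) (hM t ht) (hv t ht) n).trans_lt hn
  obtain ⟨u, hu, hUu⟩ := exists_contCausal_limit hU hCauchy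
  have hGu : ∀ T, TendstoUniformlyOn (fun n => G (U n)) (G u) atTop (Iic T) := by
    intro T
    rw [Metric.tendstoUniformlyOn_iff]
    intro ε hε
    filter_upwards [Metric.tendstoUniformlyOn_iff.1 (hUu T) (ε / (L + 1)) (by positivity)]
      with n hn t ht
    rw [dist_eq_norm]
    refine (hGsub u (U n) hu (hU n) t (ε / (L + 1)) fun s hs => ?_).trans_lt ?_
    · rw [← dist_eq_norm]
      exact (hn s (hs.trans ht)).le
    · rw [mul_div_assoc', div_lt_iff₀ (by positivity)]
      nlinarith
  have hfix : u = prim a (G u) := by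
    ext t
    have h1 := (tendstoUniformlyOn_prim (fun n => hG _ (hU n)) (hG _ hu) hGu t).tendsto_at
      (self_mem_Iic)
    have h2 := ((hUu t).tendsto_at self_mem_Iic).comp (tendsto_add_atTop_nat 1)
    simp only [Function.comp_def, hUs] at h2
    exact tendsto_nhds_unique h2 h1
  refine ⟨u, G u, (hG _ hu).cont, hu.vanish, fun t => ?_, fun t => ?_⟩
  · have := hasDerivAt_prim (a := a) (hG _ hu).cont t
    rwa [← hfix] at this
  · simp only [G, hAi]
    abel

end Solutions

/-! ### Skew-adjoint operators and their resolvents -/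

section SkewPairs

variable {H : Type*} [NormedAddCommGroup H] [InnerProductSpace ℝ H] [CompleteSpace H]
variable {V : Type*} [NormedAddCommGroup V] [InnerProductSpace ℝ V] [CompleteSpace V]

/-- An unbounded skew-adjoint operator presented by the embedding `J` of its domain, a Hilbert
space, and its action `D`, both bounded on the domain. -/
structure SkewPair (J D : V →L[ℝ] H) : Prop where
  lower : ∃ c : ℝ, 0 < c ∧ ∀ v, c * ‖v‖ ≤ √(‖J v‖ ^ 2 + ‖D v‖ ^ 2)
  skew : ∀ v, inner ℝ (D v) (J v) = 0
  maximal : ∀ y w : H, (∀ v, inner ℝ w (J v) = inner ℝ y (D v)) → ∃ v, J v = y ∧ D v = -w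

variable {J D : V →L[ℝ] H}

namespace SkewPair

/-- Polarization of the quadratic identity `skew`. -/
lemma inner_eq_neg (h : SkewPair J D) (v w : V) : inner ℝ (D v) (J w) = -inner ℝ (J v) (D w) := by
  have := h.skew (v + w)
  simp only [map_add, inner_add_left, inner_add_right, h.skew] at this
  rw [real_inner_comm (D w) (J v)]
  linarith

/-- The graph is closed. -/
lemma closed (h : SkewPair J D) {v : ℕ → V} {x y : H} (hx : Tendsto (fun n => J (v n)) atTop (𝓝 x))
    (hy : Tendsto (fun n => D (v n)) atTop (𝓝 y)) : ∃ w, J w = x ∧ D w = y := by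
  -- The adjoint identity survives the limit, and maximality then puts the limit pair into the
  -- graph.
  have := h.maximal x (-y) fun w => by
    refine tendsto_nhds_unique (hy.neg.inner (tendsto_const_nhds (x := J w)))
      ((hx.inner (tendsto_const_nhds (x := D w))).congr fun n => ?_)
    rw [inner_neg_left, h.inner_eq_neg, neg_neg]
  simpa using this

/-- Skewness removes the cross term. Hence `J + l • D` is bounded below for `l > 0`, which gives
injectivity and closed range. -/
lemma norm_sq_add (h : SkewPair J D) (l : ℝ) (v : V) :
    ‖J v + l • D v‖ ^ 2 = ‖J v‖ ^ 2 + l ^ 2 * ‖D v‖ ^ 2 := by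
  rw [norm_add_sq_real, inner_smul_right, real_inner_comm, h.skew, norm_smul, mul_pow,
    Real.norm_eq_abs, sq_abs]
  ring

/-- The resolvent of a skew-adjoint operator. -/
lemma exists_resolvent (h : SkewPair J D) {l : ℝ} (hl : 0 < l) :
    ∃ G : H →L[ℝ] V, ∀ y, J (G y) + l • D (G y) = y := by
  let S : V →L[ℝ] H := J + l • D
  have hS : ∀ v, S v = J v + l • D v := fun v => rfl
  obtain ⟨c, hc, hlow⟩ := h.lower
  have hanti : ∃ k : ℝ, 0 < k ∧ ∀ v, k * ‖v‖ ≤ ‖S v‖ := by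
    refine ⟨min 1 l * c, by positivity, fun v => ?_⟩
    have h1 : 0 < min 1 l := by positivity
    have h2 : min 1 l * √(‖J v‖ ^ 2 + ‖D v‖ ^ 2) ≤ ‖S v‖ := by
      refine abs_le_of_sq_le_sq' ?_ (norm_nonneg _) |>.2
      rw [hS, h.norm_sq_add, mul_pow, Real.sq_sqrt (by positivity)]
      have h3 : min 1 l ^ 2 ≤ 1 := by
        have := min_le_left 1 l
        nlinarith
      have h4 : min 1 l ^ 2 ≤ l ^ 2 := by
        have := min_le_right 1 l
        gcongr
      nlinarith [mul_le_mul_of_nonneg_right h3 (sq_nonneg ‖J v‖),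
        mul_le_mul_of_nonneg_right h4 (sq_nonneg ‖D v‖)]
    calc min 1 l * c * ‖v‖ = min 1 l * (c * ‖v‖) := mul_assoc _ _ _
      _ ≤ min 1 l * √(‖J v‖ ^ 2 + ‖D v‖ ^ 2) := by gcongr; exact hlow v
      _ ≤ _ := h2
  obtain ⟨k, hk, hlow'⟩ := hanti
  have hK : AntilipschitzWith ⟨k⁻¹, by positivity⟩ S :=
    ContinuousLinearMap.antilipschitz_of_bound S fun v => by
      show ‖v‖ ≤ k⁻¹ * ‖S v‖
      rw [inv_mul_eq_div, le_div_iff₀ hk, mul_comm]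
      exact hlow' v
  have hker : S.ker = ⊥ := LinearMap.ker_eq_bot.2 hK.injective
  have hclosed : IsClosed (S.range : Set H) := by
    have h1 : (S.range : Set H) = Set.range S := rfl
    rw [h1]
    exact hK.isClosed_range S.uniformContinuous
  have hrange : S.range = ⊤ := by
    have : CompleteSpace S.range := hclosed.completeSpace_coe
    rw [← Submodule.orthogonal_eq_bot_iff, Submodule.eq_bot_iff]
    intro z hz
    have hz' : ∀ v, inner ℝ z (J v) + l * inner ℝ z (D v) = 0 := by
      intro v
      have := Submodule.inner_left_of_mem_orthogonal (LinearMap.mem_range_self S.toLinearMap v) hz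
      simpa [hS, inner_add_right, inner_smul_right] using this
    -- A vector orthogonal to the range lies in the domain and is an eigenvector of the operator for
    -- the real number `l⁻¹`; skewness forces it to vanish.
    obtain ⟨v, hv, hv'⟩ := h.maximal z (-l⁻¹ • z) fun v => by
      rw [inner_smul_left]
      have := hz' v
      simp only [conj_trivial]
      field_simp
      linarith
    have h1 := h.skew v
    rw [hv, hv', neg_smul, neg_neg, inner_smul_left] at h1
    simpa [hl.ne'] using h1
  let E := ContinuousLinearEquiv.ofBijective S hker hrange
  refine ⟨E.symm, fun y => ?_⟩
  rw [← hS]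
  exact ContinuousLinearEquiv.ofBijective_apply_symm_apply S hker hrange y

end SkewPair

end SkewPairs

/-! ### From the unbounded operator `P` to bounded maps on its domain -/

section SpatialOperator

variable {H : Type*} [NormedAddCommGroup H] [InnerProductSpace ℝ H] [CompleteSpace H]
variable {V : Type*} [NormedAddCommGroup V] [InnerProductSpace ℝ V] [CompleteSpace V]

/-- A skew-adjoint operator in the sense of `IsSpatialOperator` is given by a skew pair. -/
lemma IsSpatialOperator.exists_skewPair {P : H →ₗ.[ℝ] H} {e : V ≃ₗ[ℝ] P.domain}
    (hP : IsSpatialOperator P e) :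
    ∃ J D : V →L[ℝ] H, SkewPair J D ∧ (∀ v, J v = e v) ∧ ∀ v, D v = P (e v) := by
  obtain ⟨c, C, hc, hcC⟩ := hP.graphNorm
  have hJ : ∀ v, ‖(e v : H)‖ ≤ C * ‖v‖ := fun v =>
    (Real.le_sqrt_of_sq_le (by nlinarith [sq_nonneg ‖P (e v)‖])).trans (hcC v).2
  have hD : ∀ v, ‖P (e v)‖ ≤ C * ‖v‖ := fun v =>
    (Real.le_sqrt_of_sq_le (by nlinarith [sq_nonneg ‖(e v : H)‖])).trans (hcC v).2
  let J : V →L[ℝ] H := (P.domain.subtype ∘ₗ e.toLinearMap).mkContinuous C hJ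
  let D : V →L[ℝ] H := (P.toFun ∘ₗ e.toLinearMap).mkContinuous C hD
  have hJe : ∀ v, J v = e v := fun v => rfl
  have hDe : ∀ v, D v = P (e v) := fun v => rfl
  have hformal : (-P).IsFormalAdjoint P := by
    rw [← hP.skewAdjoint]
    exact LinearPMap.adjoint_isFormalAdjoint hP.dense
  refine ⟨J, D, ⟨⟨c, hc, fun v => (hcC v).1⟩, fun v => ?_, fun y w hyw => ?_⟩, hJe, hDe⟩
  · have h1 := hformal (e v) (e v)
    have h2 : (-P) (e v) = -P (e v) := rfl
    rw [h2, inner_neg_left, real_inner_comm] at h1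
    rw [hJe, hDe, real_inner_comm]
    linarith
  · have hyw' : ∀ x : P.domain, inner ℝ w (x : H) = inner ℝ y (P x) := fun x => by
      simpa [hJe, hDe] using hyw (e.symm x)
    have h1 : y ∈ P.adjoint.domain := P.mem_adjoint_domain_of_exists y ⟨w, hyw'⟩
    have h2 : P.adjoint ⟨y, h1⟩ = w := LinearPMap.adjoint_apply_eq hP.dense ⟨y, h1⟩ hyw'
    have h3 : ∀ T : H →ₗ.[ℝ] H, T = -P → ∀ hy : y ∈ T.domain, T ⟨y, hy⟩ = w →
        ∃ hy : y ∈ P.domain, P ⟨y, hy⟩ = -w := by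
      rintro T rfl hy hw
      refine ⟨hy, ?_⟩
      rw [← hw]
      exact (neg_neg _).symm
    obtain ⟨hy, hw⟩ := h3 _ hP.skewAdjoint h1 h2
    exact ⟨e.symm ⟨y, hy⟩, by simp [hJe], by simp [hDe, hw]⟩

end SpatialOperator

/-! ### Existence of strong solutions by Yosida approximation -/

section Existence

variable {H : Type*} [NormedAddCommGroup H] [InnerProductSpace ℝ H] [CompleteSpace H]
variable {V : Type*} [NormedAddCommGroup V] [InnerProductSpace ℝ V] [CompleteSpace V]

/-- `G n` is the resolvent `(1 + (n + 1)⁻¹ P)⁻¹`, so that `D ∘ G n` are the Yosida approximations. -/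
def IsYosida (J D : V →L[ℝ] H) (G : ℕ → H →L[ℝ] V) : Prop :=
  ∀ n y, J (G n y) + (1 / ((n : ℝ) + 1)) • D (G n y) = y

/-- `w` is the limit of the solutions of the Yosida approximations with right-hand side `g`. -/
def MildSol (D : V →L[ℝ] H) (G : ℕ → H →L[ℝ] V) (A B : H →L[ℝ] H) (Q : ℝ → H →L[ℝ] H) (a : ℝ)
    (g w : ℝ → H) : Prop :=
  ∃ W W' : ℕ → ℝ → H, (∀ n, EvolSol A B Q a (fun t => D (G n (W n t))) g (W n) (W' n)) ∧
    ∀ T, TendstoUniformlyOn W w atTop (Iic T)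

/-- Strong solutions with derivative `u'` that vanish on `(-∞, a]`. -/
def StrongSol (J D : V →L[ℝ] H) (A B : H →L[ℝ] H) (Q : ℝ → H →L[ℝ] H) (a : ℝ)
    (f u u' : ℝ → H) : Prop :=
  ∃ v : ℝ → V, (∀ t, J (v t) = u t) ∧ EvolSol A B Q a (fun t => D (v t)) f u u'

variable {J D : V →L[ℝ] H} {G : ℕ → H →L[ℝ] V} {A B : H →L[ℝ] H} {Q : ℝ → H →L[ℝ] H}
  {a c q : ℝ}

lemma SkewPair.exists_isYosida (h : SkewPair J D) : ∃ G, IsYosida J D G := by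
  have : ∀ n : ℕ, ∃ G : H →L[ℝ] V, ∀ y, J (G y) + (1 / ((n : ℝ) + 1)) • D (G y) = y :=
    fun n => h.exists_resolvent (by positivity)
  choose G hG using this
  exact ⟨G, hG⟩

/-- With `z = G n y` one has `y = J z + λ D z`, and skewness reduces the pairing to `λ ‖D z‖²`. -/
lemma IsYosida.accretive (hG : IsYosida J D G) (h : SkewPair J D) (n : ℕ) (y : H) :
    0 ≤ inner ℝ (D (G n y)) y := by
  have h1 : inner ℝ (D (G n y)) y = (1 / ((n : ℝ) + 1)) * ‖D (G n y)‖ ^ 2 := by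
    calc inner ℝ (D (G n y)) y
        = inner ℝ (D (G n y)) (J (G n y) + (1 / ((n : ℝ) + 1)) • D (G n y)) := by rw [hG n y]
      _ = _ := by
        rw [inner_add_right, h.skew, inner_smul_right, real_inner_self_eq_norm_sq, zero_add]
  rw [h1]
  positivity

/-- The quasi-accretivity of the Yosida approximations with different parameters. -/
lemma IsYosida.inner_sub_ge (hG : IsYosida J D G) (h : SkewPair J D) {m n N : ℕ} (hm : N ≤ m)
    (hn : N ≤ n) {x y : H} {M : ℝ} (hx : ‖D (G m x)‖ ≤ M) (hy : ‖D (G n y)‖ ≤ M) :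
    -(4 * M ^ 2 * (1 / ((N : ℝ) + 1))) ≤ inner ℝ (D (G m x) - D (G n y)) (x - y) := by
  have hM : 0 ≤ M := (norm_nonneg _).trans hx
  have hle : ∀ k : ℕ, N ≤ k → 1 / ((k : ℝ) + 1) ≤ 1 / ((N : ℝ) + 1) := fun k hk => by
    have : (N : ℝ) ≤ k := by exact_mod_cast hk
    gcongr
  set l := 1 / ((N : ℝ) + 1) with hl
  have hl0 : 0 ≤ l := by positivity
  -- The part in the domain contributes nothing by skewness; what remains pairs a vector of norm at
  -- most `2 M` with one of norm at most `2 l M`.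
  have h1 : x - y = J (G m x - G n y) +
      ((1 / ((m : ℝ) + 1)) • D (G m x) - (1 / ((n : ℝ) + 1)) • D (G n y)) := by
    conv_lhs => rw [← hG m x, ← hG n y]
    rw [map_sub]
    abel
  have h2 : inner ℝ (D (G m x) - D (G n y)) (J (G m x - G n y)) = (0 : ℝ) := by
    rw [← map_sub]
    exact h.skew _
  have hs : ∀ (k : ℕ) (z : H), N ≤ k → ‖z‖ ≤ M → ‖(1 / ((k : ℝ) + 1)) • z‖ ≤ l * M := by
    intro k z hk hz
    rw [norm_smul, Real.norm_of_nonneg (by positivity)]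
    exact mul_le_mul (hle k hk) hz (norm_nonneg _) hl0
  rw [h1, inner_add_right, h2, zero_add]
  refine (abs_le.1 ((abs_real_inner_le_norm _ _).trans ?_)).1
  calc _ ≤ (M + M) * (l * M + l * M) := mul_le_mul (norm_sub_le_of_le hx hy)
        (norm_sub_le_of_le (hs m _ hm hx) (hs n _ hn hy)) (norm_nonneg _) (by positivity)
    _ = 4 * M ^ 2 * l := by ring

/-- A bounded `L` is absorbed into `B`. The bound then depends on `‖B + L‖`, but only existence is
taken from it; uniform bounds come from accretivity. -/
lemma CoeffBound.exists_yosida_evolSol (hC : CoeffBound c q A B Q) {g : ℝ → H}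
    (hg : ContCausal a g) (L : H →L[ℝ] H) :
    ∃ W W', EvolSol A B Q a (fun t => L (W t)) g W W' := by
  have hC' : CoeffBound c (‖B + L‖ + ∫ σ, ‖Q σ‖) A (B + L) Q :=
    ⟨hC.pos, hC.symm, hC.coercive, hC.kernel, le_rfl⟩
  obtain ⟨u, u', hu⟩ := exists_evolSol_bounded hC' hg
  refine ⟨u, u', hu.cont, hu.vanish, hu.deriv, fun t => ?_⟩
  rw [← hu.eqn t, add_apply]
  abel

lemma EvolSol.integrate_clm (hQ : IsKernel Q) {g u u' : ℝ → H} (hg : Continuous g)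
    (L : H →L[ℝ] H) (h : EvolSol A B Q a (fun t => L (u t)) g u u') :
    EvolSol A B Q a (fun t => L (prim a u t)) (prim a g) (prim a u) u := by
  have hu := h.contCausal.cont
  have h1 := h.integrate hQ (show Continuous fun t => L (u t) from L.continuous.comp hu) hg
  have h2 : prim a (fun t => L (u t)) = fun t => L (prim a u t) := by
    ext t
    exact L.intervalIntegral_comp_comm (hu.intervalIntegrable _ _)
  rwa [h2] at h1

lemma le_of_sq_le_mul_sq {x K y : ℝ} (hK : 0 ≤ K) (hy : 0 ≤ y) (h : x ^ 2 ≤ K * (0 + y ^ 2)) :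
    x ≤ √K * y := by
  refine abs_le_of_sq_le_sq' ?_ (by positivity) |>.2
  rw [mul_pow, Real.sq_sqrt hK]
  linarith

/-- The Yosida approximations converge for continuously differentiable right-hand sides. -/
theorem exists_mildSol (h : SkewPair J D) (hG : IsYosida J D G) (hC : CoeffBound c q A B Q)
    {g : ℝ → H} (hg : ContCausal a g) : ∃ w, ContCausal a w ∧ MildSol D G A B Q a (prim a g) w := by
  have hW : ∀ n, ∃ W W', EvolSol A B Q a (fun t => D (G n (W t))) g W W' := fun n =>
    hC.exists_yosida_evolSol hg (D.comp (G n))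
  choose W W' hW using hW
  have hU : ∀ n, EvolSol A B Q a (fun t => D (G n (prim a (W n) t))) (prim a g) (prim a (W n)) (W n) :=
    fun n => (hW n).integrate_clm hC.kernel hg.cont (D.comp (G n))
  have hCauchy : ∀ T, UniformCauchySeqOn (fun n => prim a (W n)) atTop (Iic T) := by
    intro T₀
    suffices hT : ∀ T, a ≤ T → UniformCauchySeqOn (fun n => prim a (W n)) atTop (Iic T) from
      (hT (max a T₀) (le_max_left _ _)).mono (Iic_subset_Iic.2 (le_max_right _ _))
    intro T haT
    obtain ⟨K, hK, hKe⟩ := evolSol_energy (H := H) q hC.pos haT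
    -- The bound does not depend on `n`: the Yosida term is accretive, so the energy estimate
    -- applies with `ε = 0`.
    have hb : ∀ f : ℝ → H, Continuous f → ∃ M, ∀ n u u',
        EvolSol A B Q a (fun t => D (G n (u t))) f u u' → ∀ t ≤ T, ‖u t‖ ≤ M := by
      intro f hf
      refine ⟨√K * ∫ s in a..T, ‖f s‖, fun n u u' hu t ht => ?_⟩
      refine le_of_sq_le_mul_sq hK.le
        (intervalIntegral.integral_nonneg haT fun _ _ => norm_nonneg _) ?_
      exact hKe A B Q hC _ f u u' 0 hu le_rfl
        (fun s _ => by rw [neg_zero]; exact hG.accretive h n _) hf t ht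
    obtain ⟨M₁, hM₁⟩ := hb g hg.cont
    obtain ⟨M₂, hM₂⟩ := hb _ hg.prim.cont
    obtain ⟨F, hF0, hF⟩ := hg.prim.exists_bound T
    -- The equation is solved for the Yosida term. The time derivative of `prim a (W n)` is `W n`,
    -- already bounded; this is where differentiable data are needed.
    obtain ⟨M, hM⟩ : ∃ M, ∀ n, ∀ t ≤ T, ‖D (G n (prim a (W n) t))‖ ≤ M := by
      refine ⟨F + ‖A‖ * M₁ + q * M₂, fun n t ht => ?_⟩
      have h1 : D (G n (prim a (W n) t)) = prim a g t - A (W n t) -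
          (B (prim a (W n) t) + memory Q (prim a (W n)) t) := by
        rw [← (hU n).eqn t]
        abel
      rw [h1]
      exact norm_sub_le_of_le (norm_sub_le_of_le (hF t ht)
        (A.le_opNorm_of_le (hM₁ n _ _ (hW n) t ht)))
        (hC.norm_lower_order_le fun s hs => hM₂ n _ _ (hU n) s (hs.trans ht))
    rw [Metric.uniformCauchySeqOn_iff]
    intro ε hε
    have hlim : Tendsto (fun N : ℕ => K * (4 * M ^ 2 * (1 / ((N : ℝ) + 1)))) atTop (𝓝 0) := by
      have := (tendsto_one_div_add_atTop_nhds_zero_nat (𝕜 := ℝ)).const_mul (4 * M ^ 2) |>.const_mul K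
      simpa using this
    obtain ⟨N, hN⟩ := (hlim.eventually (gt_mem_nhds (show 0 < ε ^ 2 by positivity))).exists
    refine ⟨N, fun m hm n hn t ht => ?_⟩
    rw [dist_eq_norm]
    -- The right-hand sides cancel, so the estimate is driven only by the defect of accretivity
    -- between different Yosida parameters.
    have hsub := (hU m).sub hC.kernel (hU n)
    have h1 := hKe A B Q hC _ _ _ _ (4 * M ^ 2 * (1 / ((N : ℝ) + 1))) hsub (by positivity)
      (fun s hs => hG.inner_sub_ge h hm hn (hM m s hs) (hM n s hs))
      (hg.prim.cont.sub hg.prim.cont) t ht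
    simp only [sub_self, norm_zero, intervalIntegral.integral_zero] at h1
    refine lt_of_pow_lt_pow_left₀ 2 hε.le ?_
    calc _ ≤ _ := h1
      _ = K * (4 * M ^ 2 * (1 / ((N : ℝ) + 1))) := by ring
      _ < _ := hN
  obtain ⟨w, hw, hlim⟩ := exists_contCausal_limit (fun n => (hU n).contCausal) hCauchy
  exact ⟨w, hw, _, _, hU, hlim⟩

/-- Mild solutions depend continuously on the right-hand side. -/
theorem mildSol_stability (h : SkewPair J D) (hG : IsYosida J D G) (hC : CoeffBound c q A B Q)
    {T : ℝ} (haT : a ≤ T) :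
    ∃ K, 0 < K ∧ ∀ g₁ g₂ w₁ w₂ : ℝ → H, Continuous g₁ → Continuous g₂ →
      MildSol D G A B Q a g₁ w₁ → MildSol D G A B Q a g₂ w₂ →
      ∀ t ≤ T, ‖w₁ t - w₂ t‖ ≤ K * ∫ s in a..T, ‖g₁ s - g₂ s‖ := by
  obtain ⟨K, hK, hKe⟩ := evolSol_energy (H := H) q hC.pos haT
  refine ⟨√K, by positivity, ?_⟩
  rintro g₁ g₂ w₁ w₂ hg₁ hg₂ ⟨W₁, W₁', hW₁, hl₁⟩ ⟨W₂, W₂', hW₂, hl₂⟩ t ht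
  refine le_of_tendsto (((hl₁ T).tendsto_at ht).sub ((hl₂ T).tendsto_at ht)).norm
    (Eventually.of_forall fun n => le_of_sq_le_mul_sq hK.le
      (intervalIntegral.integral_nonneg haT fun _ _ => norm_nonneg _) ?_)
  refine hKe A B Q hC _ _ _ _ 0 ((hW₁ n).sub hC.kernel (hW₂ n)) le_rfl (fun s _ => ?_)
    (hg₁.sub hg₂) t ht
  rw [neg_zero, ← map_sub, ← map_sub]
  exact hG.accretive h n _

lemma IsKernel.tendstoUniformlyOn_memory (hQ : IsKernel Q) {U : ℕ → ℝ → H} {u : ℝ → H}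
    (hU : ∀ n, ContCausal a (U n)) (hu : ContCausal a u) {T : ℝ}
    (hl : TendstoUniformlyOn U u atTop (Iic T)) :
    TendstoUniformlyOn (fun n => memory Q (U n)) (memory Q u) atTop (Iic T) := by
  rw [Metric.tendstoUniformlyOn_iff]
  intro ε hε
  set q := ∫ σ, ‖Q σ‖
  have hq : 0 ≤ q := integral_nonneg fun _ => norm_nonneg _
  filter_upwards [Metric.tendstoUniformlyOn_iff.1 hl (ε / (q + 1)) (by positivity)] with n hn t ht
  rw [dist_eq_norm, ← hQ.memory_sub hu (hU n)]
  refine (hQ.norm_memory_le (S := ε / (q + 1)) fun s hs => ?_).trans_lt ?_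
  · rw [← dist_eq_norm]
    exact (hn s (hs.trans ht)).le
  · rw [mul_div_assoc', div_lt_iff₀ (by positivity)]
    nlinarith

/-- A limit of approximate solutions is a strong solution, because the graph is closed. -/
lemma strongSol_of_tendsto (h : SkewPair J D) (hQ : IsKernel Q) {w : ℕ → ℝ → H} {w₀ : ℝ → H}
    (hw : ∀ n, ContCausal a (w n)) (hw₀ : ContCausal a w₀)
    (hl : ∀ T, TendstoUniformlyOn w w₀ atTop (Iic T)) {F : ℕ → ℝ → H} {F₀ : ℝ → H}
    (hF : ∀ t, Tendsto (fun n => F n t) atTop (𝓝 (F₀ t))) {v : ℕ → ℝ → V} {l : ℕ → ℝ}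
    (hl0 : Tendsto l atTop (𝓝 0)) (hv : ∀ n t, J (v n t) + l n • D (v n t) = prim a (w n) t)
    (hsol : ∀ n, EvolSol A B Q a (fun t => D (v n t)) (F n) (prim a (w n)) (w n)) :
    StrongSol J D A B Q a F₀ (prim a w₀) w₀ := by
  have key : ∀ t, ∃ v₀, J v₀ = prim a w₀ t ∧
      D v₀ = F₀ t - A (w₀ t) - B (prim a w₀ t) - memory Q (prim a w₀) t := by
    intro t
    have hp := tendstoUniformlyOn_prim hw hw₀ hl t
    have hpt := hp.tendsto_at self_mem_Iic
    have hwt := (hl t).tendsto_at self_mem_Iic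
    have hD : Tendsto (fun n => D (v n t)) atTop
        (𝓝 (F₀ t - A (w₀ t) - B (prim a w₀ t) - memory Q (prim a w₀) t)) := by
      refine Tendsto.congr (fun n => ?_) ((((hF t).sub ((A.continuous.tendsto _).comp hwt)).sub
        ((B.continuous.tendsto _).comp hpt)).sub
        ((hQ.tendstoUniformlyOn_memory (fun n => (hw n).prim) hw₀.prim hp).tendsto_at self_mem_Iic))
      rw [← (hsol n).eqn t]
      simp only [Function.comp_apply]
      abel
    -- `J (v n t)` differs from the primitive by `l n • D (v n t)`, where the second factor
    -- converges and `l n → 0`.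
    have hJ : Tendsto (fun n => J (v n t)) atTop (𝓝 (prim a w₀ t)) := by
      have := hpt.sub (hl0.smul hD)
      rw [zero_smul, sub_zero] at this
      refine this.congr fun n => ?_
      rw [← hv n t]
      abel
    exact h.closed hJ hD
  choose v₀ hv₀ hv₀' using key
  refine ⟨v₀, hv₀, hw₀.cont, hw₀.prim.vanish, hasDerivAt_prim hw₀.cont, fun t => ?_⟩
  rw [hv₀']
  abel

/-- The primitive of a mild solution is a strong solution. -/
theorem MildSol.strongSol (h : SkewPair J D) (hG : IsYosida J D G) (hC : CoeffBound c q A B Q)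
    {g w : ℝ → H} (hg : Continuous g) (hw : ContCausal a w) (hm : MildSol D G A B Q a g w) :
    StrongSol J D A B Q a (prim a g) (prim a w) w := by
  obtain ⟨W, W', hW, hl⟩ := hm
  have hU : ∀ n, EvolSol A B Q a (fun t => D (G n (prim a (W n) t))) (prim a g) (prim a (W n)) (W n) :=
    fun n => (hW n).integrate_clm hC.kernel hg (D.comp (G n))
  exact strongSol_of_tendsto h hC.kernel (fun n => (hW n).contCausal) hw hl
    (fun t => tendsto_const_nhds) (tendsto_one_div_add_atTop_nhds_zero_nat (𝕜 := ℝ))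
    (fun n t => hG n _) hU

/-- Approximation of locally integrable functions by continuously differentiable causal ones. -/
lemma exists_prim_approx {g : ℝ → H} (hg : LocallyIntegrable g volume)
    (hg0 : ∀ t ≤ a + 1, g t = 0) :
    ∃ k : ℕ → ℝ → H, (∀ n, ContCausal a (k n)) ∧
      ∀ T, Tendsto (fun n => ∫ s in a..T, ‖prim a (k n) s - g s‖) atTop (𝓝 0) := by
  have hgi : ∀ n : ℕ, MemLp ((Icc a n).indicator g) 1 volume := fun n => by
    rw [memLp_one_iff_integrable, integrable_indicator_iff measurableSet_Icc]
    exact hg.integrableOn_isCompact isCompact_Icc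
  choose φ hφc hφs hφ using fun n : ℕ => (hgi n).exist_eLpNorm_sub_le (by simp) le_rfl
    (show (0 : ℝ) < 1 / ((n : ℝ) + 1) by positivity)
  -- Zero up to `a + 1/2` and one from `a + 1` on: the approximants become causal, while the
  -- transition takes place where `g` vanishes.
  let χ : ℝ → ℝ := fun t => Real.smoothTransition (2 * (t - a) - 1)
  have hχ : ContDiff ℝ ∞ χ := Real.smoothTransition.contDiff.comp (by fun_prop)
  have hψ : ∀ n, ContDiff ℝ ∞ fun t => χ t • φ n t := fun n => hχ.smul (hφs n)
  have hψ0 : ∀ n, ∀ t < a + 1 / 2, χ t • φ n t = 0 := fun n t ht => by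
    have : χ t = 0 := Real.smoothTransition.zero_of_nonpos (by linarith)
    rw [this, zero_smul]
  have hk : ∀ n, ContCausal a (deriv fun t => χ t • φ n t) := by
    refine fun n => ⟨(hψ n).continuous_deriv (by simp), fun t ht => ?_⟩
    have : (fun t => χ t • φ n t) =ᶠ[𝓝 t] fun _ => 0 := by
      filter_upwards [Iio_mem_nhds (show t < a + 1 / 2 by linarith)] with s hs using hψ0 n s hs
    rw [this.deriv_eq, deriv_const]
  have hprim : ∀ n, prim a (deriv fun t => χ t • φ n t) = fun t => χ t • φ n t := by
    intro n
    ext t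
    rw [prim, intervalIntegral.integral_deriv_eq_sub
      (fun s _ => (hψ n).differentiable (by simp) s) ((hk n).cont.intervalIntegrable _ _),
      hψ0 n a (by linarith), sub_zero]
  refine ⟨_, hk, fun T => ?_⟩
  have hint : ∀ n : ℕ, Integrable (fun t => (Icc a (n : ℝ)).indicator g t - φ n t) volume := fun n =>
    (memLp_one_iff_integrable.1 (hgi n)).sub ((hφs n).continuous.integrable_of_hasCompactSupport (hφc n))
  have hbound : ∀ n : ℕ, ∫ t, ‖(Icc a (n : ℝ)).indicator g t - φ n t‖ ≤ 1 / ((n : ℝ) + 1) := by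
    intro n
    rw [integral_norm_eq_lintegral_enorm (hint n).aestronglyMeasurable]
    refine ENNReal.toReal_le_of_le_ofReal (by positivity) ?_
    have := hφ n
    rwa [eLpNorm_one_eq_lintegral_enorm] at this
  rcases lt_or_ge T a with hTa | haT
  · refine tendsto_const_nhds.congr fun n => ?_
    rw [hprim, intervalIntegral.integral_symm, intervalIntegral.integral_of_le hTa.le,
      setIntegral_eq_zero_of_forall_eq_zero, neg_zero]
    intro t ht
    simp only
    rw [hψ0 n t (by linarith [ht.2]), hg0 t (by linarith [ht.2]), sub_zero, norm_zero]
  refine squeeze_zero' (g := fun n : ℕ => 1 / ((n : ℝ) + 1)) (Eventually.of_forall fun n =>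
    intervalIntegral.integral_nonneg haT fun _ _ => norm_nonneg _) ?_
    (tendsto_one_div_add_atTop_nhds_zero_nat (𝕜 := ℝ))
  obtain ⟨N, hN⟩ := exists_nat_ge T
  filter_upwards [eventually_ge_atTop N] with n hn
  have hTn : T ≤ n := hN.trans (by exact_mod_cast hn)
  rw [hprim]
  calc ∫ s in a..T, ‖χ s • φ n s - g s‖
      ≤ ∫ s in a..T, ‖(Icc a (n : ℝ)).indicator g s - φ n s‖ := by
        refine intervalIntegral.integral_mono_on haT ?_ (hint n).norm.intervalIntegrable fun s hs => ?_
        · exact (((hψ n).continuous.intervalIntegrable _ _).sub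
            (hg.integrableOn_isCompact isCompact_uIcc).intervalIntegrable).norm
        · rw [indicator_of_mem (show s ∈ Icc a (n : ℝ) from ⟨hs.1, hs.2.trans hTn⟩)]
          rcases le_total s (a + 1) with h1 | h1
          · rw [hg0 s h1, sub_zero, zero_sub, norm_neg, norm_smul,
              Real.norm_of_nonneg (Real.smoothTransition.nonneg _)]
            exact mul_le_of_le_one_left (norm_nonneg _) (Real.smoothTransition.le_one _)
          · have : χ s = 1 := Real.smoothTransition.one_of_one_le (by linarith)
            rw [this, one_smul, norm_sub_rev]
    _ ≤ ∫ s, ‖(Icc a (n : ℝ)).indicator g s - φ n s‖ := by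
        rw [intervalIntegral.integral_of_le haT]
        exact setIntegral_le_integral (hint n).norm (Eventually.of_forall fun _ => norm_nonneg _)
    _ ≤ _ := hbound n

/-- Stability in `L¹` turns `L¹` convergence of the data into uniform Cauchy sequences. -/
lemma uniformCauchySeqOn_of_stability {w F : ℕ → ℝ → H} {g : ℝ → H} (hF : ∀ n, Continuous (F n))
    (hg : LocallyIntegrable g volume)
    (hFl : ∀ T, Tendsto (fun n => ∫ s in a..T, ‖F n s - g s‖) atTop (𝓝 0))
    (hst : ∀ T, a ≤ T → ∃ K, 0 < K ∧ ∀ m n, ∀ t ≤ T,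
      ‖w m t - w n t‖ ≤ K * ∫ s in a..T, ‖F m s - F n s‖) (T₀ : ℝ) :
    UniformCauchySeqOn w atTop (Iic T₀) := by
  have hii : ∀ n b d, IntervalIntegrable (fun s => F n s - g s) volume b d := fun n b d =>
    ((hF n).intervalIntegrable _ _).sub
      (hg.integrableOn_isCompact isCompact_uIcc).intervalIntegrable
  suffices hT : ∀ T, a ≤ T → UniformCauchySeqOn w atTop (Iic T) from
    (hT (max a T₀) (le_max_left _ _)).mono (Iic_subset_Iic.2 (le_max_right _ _))
  intro T haT
  obtain ⟨K, hK, hKe⟩ := hst T haT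
  rw [Metric.uniformCauchySeqOn_iff]
  intro ε hε
  obtain ⟨N, hN⟩ := eventually_atTop.1
    ((hFl T).eventually (gt_mem_nhds (show 0 < ε / (2 * K) by positivity)))
  refine ⟨N, fun m hm n hn t ht => ?_⟩
  rw [dist_eq_norm]
  have h1 : ∫ s in a..T, ‖F m s - F n s‖ ≤
      (∫ s in a..T, ‖F m s - g s‖) + ∫ s in a..T, ‖F n s - g s‖ := by
    rw [← intervalIntegral.integral_add (hii m _ _).norm (hii n _ _).norm]
    refine intervalIntegral.integral_mono_on haT
      (((hF m).sub (hF n)).norm.intervalIntegrable _ _)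
      ((hii m _ _).norm.add (hii n _ _).norm) fun s _ => ?_
    rw [← dist_eq_norm, ← dist_eq_norm, ← dist_eq_norm, dist_comm (F n s)]
    exact dist_triangle _ _ _
  calc ‖w m t - w n t‖ ≤ K * ∫ s in a..T, ‖F m s - F n s‖ := hKe m n t ht
    _ < K * (ε / (2 * K) + ε / (2 * K)) :=
        mul_lt_mul_of_pos_left (h1.trans_lt (add_lt_add (hN m hm) (hN n hn))) hK
    _ = ε := by field_simp; ring

/-- Existence of strong solutions if the right-hand side is a primitive of a locally integrable
function. -/
theorem exists_strongSol (h : SkewPair J D) (hC : CoeffBound c q A B Q) {g : ℝ → H}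
    (hg : LocallyIntegrable g volume) (hg0 : ∀ t ≤ a + 1, g t = 0) :
    ∃ u u', StrongSol J D A B Q a (prim a g) u u' := by
  obtain ⟨G, hG⟩ := h.exists_isYosida
  obtain ⟨k, hk, hkl⟩ := exists_prim_approx hg hg0
  choose w hw hm using fun n => exists_mildSol h hG hC (hk n)
  have hii : ∀ n b d, IntervalIntegrable (fun s => prim a (k n) s - g s) volume b d := fun n b d =>
    ((hk n).prim.cont.intervalIntegrable _ _).sub
      (hg.integrableOn_isCompact isCompact_uIcc).intervalIntegrable
  have hCauchy : ∀ T, UniformCauchySeqOn w atTop (Iic T) := by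
    refine uniformCauchySeqOn_of_stability (fun n => (hk n).prim.cont) hg hkl fun T haT => ?_
    obtain ⟨K, hK, hKe⟩ := mildSol_stability h hG hC haT
    exact ⟨K, hK, fun m n =>
      hKe _ _ _ _ (hk m).prim.cont (hk n).prim.cont (hm m) (hm n)⟩
  obtain ⟨w₀, hw₀, hl⟩ := exists_contCausal_limit hw hCauchy
  choose v hv hv' using fun n => (hm n).strongSol h hG hC (hk n).prim.cont (hw n)
  -- The approximants are already strong solutions, so the regularization parameter `l` is zero.
  refine ⟨_, _, strongSol_of_tendsto h hC.kernel hw hw₀ hl (F := fun n => prim a (prim a (k n)))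
    (fun t => ?_) (v := v) (l := fun _ => 0) tendsto_const_nhds (fun n t => by simp [hv]) hv'⟩
  rw [tendsto_iff_norm_sub_tendsto_zero]
  refine squeeze_zero (fun _ => norm_nonneg _) (fun n => ?_) (hkl t)
  have h1 : prim a (prim a (k n)) t - prim a g t = prim a (fun s => prim a (k n) s - g s) t := by
    rw [prim, prim, ← intervalIntegral.integral_sub ((hk n).prim.cont.intervalIntegrable _ _)
      (hg.integrableOn_isCompact isCompact_uIcc).intervalIntegrable]
    rfl
  rw [h1]
  refine norm_prim_le (fun s hs => ?_) (hii n _ _) t le_rfl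
  rw [(hk n).prim.vanish s hs, hg0 s (by linarith), sub_zero]

end Existence

/-! ### Continuous `H¹` functions as primitives -/

section Sobolev

variable {H : Type*} [NormedAddCommGroup H] [InnerProductSpace ℝ H] [CompleteSpace H]

lemma deriv_smoothTransition_eq_zero {y : ℝ} (hy : y ∉ Icc (0 : ℝ) 1) :
    deriv Real.smoothTransition y = 0 := by
  rcases not_and_or.1 hy with h | h
  · have : Real.smoothTransition =ᶠ[𝓝 y] fun _ => 0 := by
      filter_upwards [Iio_mem_nhds (not_le.1 h)] with s hs
        using Real.smoothTransition.zero_of_nonpos (le_of_lt hs)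
    rw [this.deriv_eq, deriv_const]
  · have : Real.smoothTransition =ᶠ[𝓝 y] fun _ => 1 := by
      filter_upwards [Ioi_mem_nhds (not_le.1 h)] with s hs
        using Real.smoothTransition.one_of_one_le (le_of_lt hs)
    rw [this.deriv_eq, deriv_const]

lemma continuous_deriv_smoothTransition : Continuous (deriv Real.smoothTransition) :=
  (Real.smoothTransition.contDiff (n := 1)).continuous_deriv le_rfl

lemma hasCompactSupport_deriv_smoothTransition : HasCompactSupport (deriv Real.smoothTransition) :=
  HasCompactSupport.intro isCompact_Icc fun _ hy => deriv_smoothTransition_eq_zero hy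

lemma integral_deriv_smoothTransition : ∫ y, deriv Real.smoothTransition y = 1 := by
  have hsupp : Function.support (deriv Real.smoothTransition) ⊆ Ioc (-1) 1 := by
    intro y hy
    by_contra h
    exact hy (deriv_smoothTransition_eq_zero fun h' => h ⟨by linarith [h'.1], h'.2⟩)
  rw [← intervalIntegral.integral_eq_integral_of_support_subset hsupp,
    intervalIntegral.integral_deriv_eq_sub
      (fun s _ => (Real.smoothTransition.contDiff (n := 1)).differentiable (by simp) s)
      (continuous_deriv_smoothTransition.intervalIntegrable _ _),
    Real.smoothTransition.one_of_one_le le_rfl,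
    Real.smoothTransition.zero_of_nonpos (by norm_num), sub_zero]

/-- The rescaled derivative of `Real.smoothTransition` is a one-sided approximate identity: it has
mass one and lives on `[s, s + 1/(n+1)]`. -/
lemma tendsto_integral_rescaled {f : ℝ → H} (hf : Continuous f) (s : ℝ) :
    Tendsto (fun n : ℕ => ∫ r, (((n : ℝ) + 1) * deriv Real.smoothTransition (((n : ℝ) + 1) * (r - s))) •
      f r) atTop (𝓝 (f s)) := by
  have h1 : ∀ n : ℕ, ∫ r, (((n : ℝ) + 1) * deriv Real.smoothTransition (((n : ℝ) + 1) * (r - s))) • f r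
      = ∫ y, deriv Real.smoothTransition y • f (s + (1 / ((n : ℝ) + 1)) * y) := by
    intro n
    have hn : (0 : ℝ) < n + 1 := by positivity
    let k : ℝ → H := fun y => deriv Real.smoothTransition y • f (s + (1 / ((n : ℝ) + 1)) * y)
    have h2 : ∀ r, (((n : ℝ) + 1) * deriv Real.smoothTransition (((n : ℝ) + 1) * (r - s))) • f r =
        ((n : ℝ) + 1) • k (((n : ℝ) + 1) * (r - s)) := by
      intro r
      simp only [k]
      rw [mul_smul, ← mul_assoc, one_div_mul_cancel hn.ne', one_mul, add_sub_cancel]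
    simp_rw [h2]
    rw [integral_smul, integral_sub_right_eq_self (fun r => k (((n : ℝ) + 1) * r)) s,
      Measure.integral_comp_mul_left, abs_of_pos (by positivity), smul_smul,
      mul_inv_cancel₀ hn.ne', one_smul]
  simp_rw [h1]
  have h3 : f s = ∫ y, deriv Real.smoothTransition y • f s := by
    rw [integral_smul_const, integral_deriv_smoothTransition, one_smul]
  rw [h3]
  obtain ⟨C, hC⟩ := (isCompact_Icc (a := s) (b := s + 1)).exists_bound_of_continuousOn hf.continuousOn
  refine tendsto_integral_of_dominated_convergence
    (fun y => ‖deriv Real.smoothTransition y‖ * C) (fun n => ?_) ?_ (fun n => ?_) ?_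
  · exact (continuous_deriv_smoothTransition.smul (hf.comp (by fun_prop))).aestronglyMeasurable
  · exact ((continuous_deriv_smoothTransition.integrable_of_hasCompactSupport
      hasCompactSupport_deriv_smoothTransition).norm.mul_const C)
  · refine Eventually.of_forall fun y => ?_
    by_cases hy : y ∈ Icc (0 : ℝ) 1
    · rw [norm_smul]
      have h4 : (1 : ℝ) / ((n : ℝ) + 1) ≤ 1 := by
        rw [div_le_one (by positivity)]
        linarith [Nat.cast_nonneg (α := ℝ) n]
      have h5 : 0 ≤ 1 / ((n : ℝ) + 1) * y := mul_nonneg (by positivity) hy.1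
      have h6 : 1 / ((n : ℝ) + 1) * y ≤ 1 := mul_le_one₀ h4 hy.1 hy.2
      have := hC (s + 1 / ((n : ℝ) + 1) * y) ⟨by linarith, by linarith⟩
      gcongr
    · simp [deriv_smoothTransition_eq_zero hy]
  · refine Eventually.of_forall fun y => Tendsto.const_smul ?_ _
    refine (hf.tendsto s).comp ?_
    have := ((tendsto_one_div_add_atTop_nhds_zero_nat (𝕜 := ℝ)).mul_const y).const_add s
    simpa using this

/-- A continuous function is a primitive of its weak derivative. -/
lemma IsWeakDeriv.sub_eq_integral {f g : ℝ → H} (h : IsWeakDeriv f g) (hf : Continuous f)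
    (hg : LocallyIntegrable g volume) {s t : ℝ} (hst : s ≤ t) :
    f t - f s = ∫ r in s..t, g r := by
  -- A smoothed indicator of `(s, t]`, whose derivative is the difference of approximate identities
  -- at `s` and at `t`.
  let η : ℕ → ℝ → ℝ := fun n r => Real.smoothTransition (((n : ℝ) + 1) * (r - s)) -
    Real.smoothTransition (((n : ℝ) + 1) * (r - t))
  have hη : ∀ n, ContDiff ℝ ∞ (η n) := fun n =>
    (Real.smoothTransition.contDiff.comp (by fun_prop)).sub
      (Real.smoothTransition.contDiff.comp (by fun_prop))
  have hη0 : ∀ n r, r ∉ Icc s (t + 1) → η n r = 0 := by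
    intro n r hr
    have hn : (0 : ℝ) < n + 1 := by positivity
    have hn0 : (0 : ℝ) ≤ n := by positivity
    rcases not_and_or.1 hr with h1 | h1
    · have h2 : r < s := not_le.1 h1
      simp only [η]
      rw [Real.smoothTransition.zero_of_nonpos (by nlinarith),
        Real.smoothTransition.zero_of_nonpos (by nlinarith), sub_zero]
    · have h2 : t + 1 < r := not_le.1 h1
      simp only [η]
      rw [Real.smoothTransition.one_of_one_le (by nlinarith),
        Real.smoothTransition.one_of_one_le (by nlinarith), sub_self]
  have hηc : ∀ n, HasCompactSupport (η n) := fun n =>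
    HasCompactSupport.intro isCompact_Icc (hη0 n)
  have hηd : ∀ n r, deriv (η n) r =
      ((n : ℝ) + 1) * deriv Real.smoothTransition (((n : ℝ) + 1) * (r - s)) -
      ((n : ℝ) + 1) * deriv Real.smoothTransition (((n : ℝ) + 1) * (r - t)) := by
    intro n r
    have h1 : ∀ b : ℝ, HasDerivAt (fun r => Real.smoothTransition (((n : ℝ) + 1) * (r - b)))
        (((n : ℝ) + 1) * deriv Real.smoothTransition (((n : ℝ) + 1) * (r - b))) r := by
      intro b
      have h2 : HasDerivAt Real.smoothTransition
          (deriv Real.smoothTransition (((n : ℝ) + 1) * (r - b))) (((n : ℝ) + 1) * (r - b)) :=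
        ((Real.smoothTransition.contDiff (n := 1)).differentiable (by simp) _).hasDerivAt
      have h3 := h2.comp r (((hasDerivAt_id r).sub_const b).const_mul ((n : ℝ) + 1))
      rw [mul_one, mul_comm] at h3
      exact h3
    exact ((h1 s).sub (h1 t)).deriv
  have hcs : ∀ (n : ℕ) (b : ℝ), HasCompactSupport fun r =>
      ((n : ℝ) + 1) * deriv Real.smoothTransition (((n : ℝ) + 1) * (r - b)) := by
    intro n b
    refine HasCompactSupport.intro (isCompact_Icc (a := b) (b := b + 1)) fun r hr => ?_
    have hn : (0 : ℝ) < n + 1 := by positivity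
    rw [deriv_smoothTransition_eq_zero, mul_zero]
    rintro ⟨h1, h2⟩
    refine hr ⟨by linarith [nonneg_of_mul_nonneg_right h1 hn], ?_⟩
    by_contra h3
    have : (0 : ℝ) ≤ n := by positivity
    nlinarith [not_le.1 h3]
  have hcont : ∀ (n : ℕ) (b : ℝ), Continuous fun r =>
      ((n : ℝ) + 1) * deriv Real.smoothTransition (((n : ℝ) + 1) * (r - b)) := fun n b =>
    continuous_const.mul (continuous_deriv_smoothTransition.comp (by fun_prop))
  have hL : Tendsto (fun n => ∫ r, deriv (η n) r • f r) atTop (𝓝 (f s - f t)) := by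
    refine ((tendsto_integral_rescaled hf s).sub (tendsto_integral_rescaled hf t)).congr fun n => ?_
    simp_rw [hηd, sub_smul]
    rw [integral_sub]
    · exact ((hcont n s).smul hf).integrable_of_hasCompactSupport (hcs n s).smul_right
    · exact ((hcont n t).smul hf).integrable_of_hasCompactSupport (hcs n t).smul_right
  have hR : Tendsto (fun n => ∫ r, η n r • g r) atTop (𝓝 (∫ r, (Ioc s t).indicator g r)) := by
    refine tendsto_integral_of_dominated_convergence (fun r => ‖(Icc s (t + 1)).indicator g r‖)
      (fun n => (hη n).continuous.aestronglyMeasurable.smul hg.aestronglyMeasurable) ?_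
      (fun n => Eventually.of_forall fun r => ?_) (Eventually.of_forall fun r => ?_)
    · exact ((integrable_indicator_iff measurableSet_Icc).2
        (hg.integrableOn_isCompact isCompact_Icc)).norm
    · by_cases hr : r ∈ Icc s (t + 1)
      · rw [indicator_of_mem hr, norm_smul]
        refine mul_le_of_le_one_left (norm_nonneg _) ?_
        have h0 := fun x => Real.smoothTransition.nonneg x
        have h1 := fun x => Real.smoothTransition.le_one x
        rw [Real.norm_eq_abs, abs_le]
        simp only [η]
        constructor <;> linarith [h0 (((n : ℝ) + 1) * (r - s)), h1 (((n : ℝ) + 1) * (r - s)),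
          h0 (((n : ℝ) + 1) * (r - t)), h1 (((n : ℝ) + 1) * (r - t))]
      · simp [hη0 n r hr]
    · have hstep : ∀ b : ℝ, Tendsto (fun n : ℕ => Real.smoothTransition (((n : ℝ) + 1) * (r - b))) atTop
          (𝓝 (if b < r then 1 else 0)) := by
        intro b
        split_ifs with hb
        · refine tendsto_const_nhds.congr' ?_
          obtain ⟨N, hN⟩ := exists_nat_ge (1 / (r - b))
          filter_upwards [eventually_ge_atTop N] with n hn
          rw [Real.smoothTransition.one_of_one_le]
          have h1 : 1 / (r - b) ≤ (n : ℝ) + 1 := by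
            have : (N : ℝ) ≤ n := by exact_mod_cast hn
            linarith
          rwa [div_le_iff₀ (by linarith)] at h1
        · refine tendsto_const_nhds.congr fun n => ?_
          rw [Real.smoothTransition.zero_of_nonpos]
          exact mul_nonpos_of_nonneg_of_nonpos (by positivity) (by linarith)
      have := ((hstep s).sub (hstep t)).smul_const (g r)
      convert! this using 2
      by_cases h1 : s < r <;> by_cases h2 : t < r
      · simp [h1, h2]
      · simp [h1, h2, not_lt.1 h2]
      · exact absurd (hst.trans_lt h2) h1
      · simp [h1, h2]
  have := tendsto_nhds_unique hL ((hR.neg).congr fun n => (h (η n) (hη n) (hηc n)).symm)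
  rw [integral_indicator measurableSet_Ioc, ← intervalIntegral.integral_of_le hst] at this
  rw [← neg_sub, this, neg_neg]

/-- Continuous causal functions in `H¹` are primitives of locally integrable functions. -/
lemma MemH1.exists_eq_prim {f : ℝ → H} (hf : MemH1 f) {a : ℝ} (hfa : ContCausal (a + 1) f) :
    ∃ g : ℝ → H, LocallyIntegrable g volume ∧ (∀ t ≤ a + 1, g t = 0) ∧ f = prim a g := by
  obtain ⟨-, g, hg, hw⟩ := hf
  have hgl : LocallyIntegrable g volume := hg.locallyIntegrable (by norm_num)
  -- The weak derivative is fixed only almost everywhere; the cut-off makes it vanish pointwise up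
  -- to `a + 1`.
  refine ⟨(Ioi (a + 1)).indicator g, hgl.indicator measurableSet_Ioi, fun t ht => ?_, ?_⟩
  · exact indicator_of_notMem (notMem_Ioi.2 ht) _
  ext t
  rcases le_total t (a + 1) with ht | ht
  · rw [hfa.vanish t ht]
    symm
    rw [prim]
    refine (intervalIntegral.integral_congr fun s hs => ?_).trans intervalIntegral.integral_zero
    refine indicator_of_notMem (notMem_Ioi.2 ?_) _
    exact hs.2.trans (max_le (by linarith) ht)
  · have h1 := hw.sub_eq_integral hfa.cont hgl ht
    rw [hfa.vanish _ le_rfl, sub_zero] at h1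
    rw [h1, prim, intervalIntegral.integral_of_le ht, intervalIntegral.integral_of_le (by linarith),
      setIntegral_indicator measurableSet_Ioi]
    congr 2
    ext s
    simp only [mem_Ioc, mem_inter_iff, mem_Ioi]
    constructor
    · rintro ⟨h2, h3⟩
      exact ⟨⟨by linarith, h3⟩, h2⟩
    · rintro ⟨⟨-, h3⟩, h2⟩
      exact ⟨h2, h3⟩

end Sobolev

/-! ### The adjoint memory operator and the weak formulation -/

section Weak

variable {H : Type*} [NormedAddCommGroup H] [InnerProductSpace ℝ H] [CompleteSpace H]
variable {V : Type*} [NormedAddCommGroup V] [InnerProductSpace ℝ V] [CompleteSpace V]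
variable {J D : V →L[ℝ] H} {A B : H →L[ℝ] H} {Q : ℝ → H →L[ℝ] H} {a c q : ℝ}

lemma memoryAdj_eq (Q : ℝ → H →L[ℝ] H) (φ : ℝ → H) (t : ℝ) :
    memoryAdj Q φ t = ∫ σ, Q σ (φ (σ + t)) := by
  rw [memoryAdj, ← integral_add_right_eq_self _ t]
  simp

lemma exists_support_bounds {φ : ℝ → H} (hφ : Continuous φ) (hc : HasCompactSupport φ) :
    ∃ T C : ℝ, (∀ t, T < t → φ t = 0) ∧ 0 ≤ C ∧ ∀ t, ‖φ t‖ ≤ C := by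
  obtain ⟨C, hC⟩ := hφ.bounded_above_of_compact_support hc
  obtain ⟨T, hT⟩ := hc.isCompact.bddAbove
  exact ⟨T, C, fun t ht => image_eq_zero_of_notMem_tsupport fun h => absurd (hT h) (not_le.2 ht),
    (norm_nonneg _).trans (hC 0), hC⟩

/-- The first form of the duality between the memory operator and its formal adjoint. -/
lemma IsKernel.integral_inner_memoryAdj (hQ : IsKernel Q) {v φ : ℝ → H}
    (hvm : AEStronglyMeasurable v volume) (hv : ∀ T, IntegrableOn v (Iic T) volume)
    (hφ : Continuous φ) (hc : HasCompactSupport φ) :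
    Integrable (fun s => inner ℝ (v s) (memoryAdj Q φ s)) volume ∧
      ∫ s, inner ℝ (v s) (memoryAdj Q φ s) =
        ∫ σ, ∫ s, inner ℝ (Q σ (v s)) (φ (σ + s)) := by
  obtain ⟨T, C, hT, hC0, hC⟩ := exists_support_bounds hφ hc
  have h1 : ∀ s, inner ℝ (v s) (memoryAdj Q φ s) = ∫ σ, inner ℝ (Q σ (v s)) (φ (σ + s)) := by
    intro s
    rw [memoryAdj_eq, ← integral_inner]
    · exact integral_congr_ae (Eventually.of_forall fun σ =>
        ((hQ.symm σ).isSymmetric (v s) (φ (σ + s))).symm)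
    · refine (hQ.integrable.norm.mul_const C).mono' ?_
        (Eventually.of_forall fun σ => (Q σ).le_opNorm_of_le (hC _))
      exact (ContinuousLinearMap.id ℝ (H →L[ℝ] H)).aestronglyMeasurable_comp₂
        hQ.integrable.aestronglyMeasurable (hφ.comp (by fun_prop)).aestronglyMeasurable
  have hint : Integrable (Function.uncurry fun s σ => inner ℝ (Q σ (v s)) (φ (σ + s)))
      (volume.prod volume) := by
    -- The integrand is nonzero only if `σ ≥ 0` and `σ + s ≤ T`, hence `s ≤ T`; so integrability of
    -- `v` on half-axes suffices for Fubini.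
    have hb : Integrable (fun z : ℝ × ℝ => ‖(Iic T).indicator v z.1‖ * (‖Q z.2‖ * C))
        (volume.prod volume) :=
      (((integrable_indicator_iff measurableSet_Iic).2 (hv T)).norm).mul_prod
        (hQ.integrable.norm.mul_const C)
    refine hb.mono' ?_ (Eventually.of_forall fun z => ?_)
    · refine AEStronglyMeasurable.inner ?_ (hφ.comp (by fun_prop)).aestronglyMeasurable
      exact (ContinuousLinearMap.id ℝ (H →L[ℝ] H)).aestronglyMeasurable_comp₂
        hQ.integrable.aestronglyMeasurable.comp_snd hvm.comp_fst
    · obtain ⟨s, σ⟩ := z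
      simp only [Function.uncurry_apply_pair]
      rcases lt_or_ge σ 0 with h | h
      · rw [hQ.causal σ h]
        simp
      · by_cases hs : s ∈ Iic T
        · rw [indicator_of_mem hs]
          calc ‖inner ℝ (Q σ (v s)) (φ (σ + s))‖ ≤ ‖Q σ (v s)‖ * ‖φ (σ + s)‖ :=
                norm_inner_le_norm _ _
            _ ≤ (‖Q σ‖ * ‖v s‖) * C := mul_le_mul ((Q σ).le_opNorm _) (hC _) (norm_nonneg _)
                (by positivity)
            _ = _ := by ring
        · rw [hT (σ + s) (by linarith [not_le.1 (show ¬ s ≤ T from hs)]), inner_zero_right, norm_zero]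
          positivity
  simp_rw [h1]
  exact ⟨hint.integral_prod_left, integral_integral_swap hint⟩

lemma ContCausal.integrableOn_Iic {u : ℝ → H} (hu : ContCausal a u) (T : ℝ) :
    IntegrableOn u (Iic T) volume := by
  have h1 : IntegrableOn u (Icc a T) volume := hu.cont.continuousOn.integrableOn_compact isCompact_Icc
  refine h1.of_forall_sdiff_eq_zero measurableSet_Iic fun t ht => hu.vanish t ?_
  by_contra h
  exact ht.2 ⟨(not_le.1 h).le, ht.1⟩

/-- Duality between the memory operator and its formal adjoint. -/
lemma IsKernel.integral_inner_memory (hQ : IsKernel Q) {u φ : ℝ → H} (hu : ContCausal a u)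
    (hφ : Continuous φ) (hc : HasCompactSupport φ) :
    ∫ s, inner ℝ (u s) (memoryAdj Q φ s) = ∫ s, inner ℝ (memory Q u s) (φ s) := by
  obtain ⟨T, C, hT, hC0, hC⟩ := exists_support_bounds hφ hc
  obtain ⟨S, hS0, hS⟩ := hu.exists_bound T
  have h1 : ∀ σ, ∫ s, inner ℝ (Q σ (u s)) (φ (σ + s)) =
      ∫ τ, inner ℝ (Q σ (u (τ - σ))) (φ τ) := by
    intro σ
    rw [← integral_sub_right_eq_self _ σ]
    simp
  have h2 : ∀ τ, inner ℝ (memory Q u τ) (φ τ) = ∫ σ, inner ℝ (Q σ (u (τ - σ))) (φ τ) := by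
    intro τ
    rw [memory_eq, real_inner_comm, ← integral_inner (hQ.integrable_apply hu τ)]
    simp_rw [real_inner_comm]
  have hint : Integrable (Function.uncurry fun σ τ => inner ℝ (Q σ (u (τ - σ))) (φ τ))
      (volume.prod volume) := by
    have hb : Integrable (fun z : ℝ × ℝ => (‖Q z.1‖ * S) * ‖φ z.2‖) (volume.prod volume) :=
      (hQ.integrable.norm.mul_const S).mul_prod (hφ.integrable_of_hasCompactSupport hc).norm
    refine hb.mono' ?_ (Eventually.of_forall fun z => ?_)
    · refine AEStronglyMeasurable.inner ?_ (hφ.comp (by fun_prop)).aestronglyMeasurable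
      exact (ContinuousLinearMap.id ℝ (H →L[ℝ] H)).aestronglyMeasurable_comp₂
        hQ.integrable.aestronglyMeasurable.comp_fst (hu.cont.comp (by fun_prop)).aestronglyMeasurable
    · obtain ⟨σ, τ⟩ := z
      simp only [Function.uncurry_apply_pair]
      by_cases hτ : T < τ
      · rw [hT τ hτ]
        simp
      · refine (norm_inner_le_norm _ _).trans (mul_le_mul_of_nonneg_right ?_ (norm_nonneg _))
        exact hQ.norm_apply_le (fun s hs => hS s (hs.trans (not_lt.1 hτ))) σ
  rw [(hQ.integral_inner_memoryAdj hu.cont.aestronglyMeasurable hu.integrableOn_Iic hφ hc).2]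
  simp_rw [h1, h2]
  exact integral_integral_swap hint

/-- The left-hand side of the weak formulation, for a continuous causal function. -/
lemma weakForm_eq (hQ : IsKernel Q) {u : ℝ → H} (hu : ContCausal a u) {φ : ℝ → V}
    (hφ : ContDiff ℝ ∞ φ) (hc : HasCompactSupport φ) :
    ∫ t, inner ℝ (u t) (A (J (deriv φ t)) + D (φ t) - B.adjoint (J (φ t))
        - memoryAdj Q (fun s => J (φ s)) t) =
      (∫ t, inner ℝ (u t) (A (J (deriv φ t)) + D (φ t) - B.adjoint (J (φ t)))) -
        ∫ t, inner ℝ (memory Q u t) (J (φ t)) := by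
  have hJφ : Continuous fun t => J (φ t) := J.continuous.comp hφ.continuous
  have hcJ : HasCompactSupport fun t => J (φ t) := hc.comp_left (map_zero J)
  have hφ' : Continuous (deriv φ) := hφ.continuous_deriv (by simp)
  rw [← hQ.integral_inner_memory hu hJφ hcJ, ← integral_sub]
  · simp_rw [← inner_sub_right]
  · refine Continuous.integrable_of_hasCompactSupport ?_ ?_
    · have := hu.cont
      have := hφ.continuous
      fun_prop
    · refine HasCompactSupport.intro (hc.isCompact) fun t ht => ?_
      have h1 : φ t = 0 := image_eq_zero_of_notMem_tsupport ht
      have h2 : deriv φ t = 0 := by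
        by_contra h
        exact ht (support_deriv_subset h)
      simp [h1, h2]
  · exact (hQ.integral_inner_memoryAdj hu.cont.aestronglyMeasurable hu.integrableOn_Iic hJφ hcJ).1

/-- Strong solutions satisfy the weak formulation. -/
lemma StrongSol.weak_eq (h : SkewPair J D) (hA : IsSelfAdjoint A) (hQ : IsKernel Q)
    {f u u' : ℝ → H} (hs : StrongSol J D A B Q a f u u') (hf : Continuous f) {φ : ℝ → V}
    (hφ : ContDiff ℝ ∞ φ) (hc : HasCompactSupport φ) :
    (∫ t, inner ℝ (u t) (A (J (deriv φ t)) + D (φ t) - B.adjoint (J (φ t)))) -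
        ∫ t, inner ℝ (memory Q u t) (J (φ t)) = -∫ t, inner ℝ (f t) (J (φ t)) := by
  obtain ⟨v, hv, hs⟩ := hs
  have hu := hs.contCausal
  have hR := (hQ.contCausal_memory hu).cont
  have hu' := hs.cont
  have huc := hu.cont
  have hφ0 := hφ.continuous
  have hφ' : Continuous (deriv φ) := hφ.continuous_deriv (by simp)
  have hsupp : ∀ t, t ∉ tsupport φ → φ t = 0 ∧ deriv φ t = 0 := fun t ht =>
    ⟨image_eq_zero_of_notMem_tsupport ht, by
      by_contra h
      exact ht (support_deriv_subset h)⟩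
  have hint : ∀ k : ℝ → ℝ, Continuous k → (∀ t, φ t = 0 → deriv φ t = 0 → k t = 0) →
      Integrable k volume := fun k hk h0 =>
    hk.integrable_of_hasCompactSupport (HasCompactSupport.intro hc.isCompact fun t ht =>
      h0 t (hsupp t ht).1 (hsupp t ht).2)
  -- The integrand is the derivative of the compactly supported function `⟨A u, J φ⟩`.
  have hX : ∫ t, (inner ℝ (A (u t)) (J (deriv φ t)) + inner ℝ (A (u' t)) (J (φ t))) = (0 : ℝ) := by
    refine integral_eq_zero_of_hasDerivAt_of_integrable
      (f := fun t => inner ℝ (A (u t)) (J (φ t))) (fun t => ?_) ?_ ?_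
    · have hφd : HasDerivAt φ (deriv φ t) t := (hφ.differentiable (by simp) t).hasDerivAt
      exact (A.hasFDerivAt.comp_hasDerivAt t (hs.deriv t)).inner ℝ
        (J.hasFDerivAt.comp_hasDerivAt t hφd)
    · exact hint _ (by fun_prop) fun t h1 h2 => by simp [h1, h2]
    · exact hint _ (by fun_prop) fun t h1 h2 => by simp [h1]
  have hpt : ∀ t, inner ℝ (u t) (A (J (deriv φ t)) + D (φ t) - B.adjoint (J (φ t))) =
      (inner ℝ (A (u t)) (J (deriv φ t)) + inner ℝ (A (u' t)) (J (φ t))) -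
        inner ℝ (f t) (J (φ t)) + inner ℝ (memory Q u t) (J (φ t)) := by
    intro t
    have h1 : inner ℝ (A (u t)) (J (deriv φ t)) = inner ℝ (u t) (A (J (deriv φ t))) :=
      hA.isSymmetric _ _
    rw [← hs.eqn t, inner_sub_right, inner_add_right, ContinuousLinearMap.adjoint_inner_right, ← h1,
      ← hv t]
    simp only [inner_add_left]
    rw [h.inner_eq_neg]
    ring
  simp_rw [hpt]
  rw [integral_add, integral_sub, hX]
  · ring
  · exact hint _ (by fun_prop) fun t h1 h2 => by simp [h1, h2]
  · exact hint _ (by fun_prop) fun t h1 h2 => by simp [h1]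
  · exact hint _ (by fun_prop) fun t h1 h2 => by simp [h1, h2]
  · exact hint _ (by fun_prop) fun t h1 h2 => by simp [h1]

/-- Convergence in `L¹` on half-axes implies convergence against compactly supported functions. -/
lemma tendsto_integral_inner {w : ℕ → ℝ → H} {w₀ φ : ℝ → H} (hw : ∀ n, ContCausal a (w n))
    (hw₀ : ContCausal a w₀)
    (hl : ∀ T, Tendsto (fun n => ∫ s in a..T, ‖w n s - w₀ s‖) atTop (𝓝 0))
    (hφ : Continuous φ) (hc : HasCompactSupport φ) :
    Tendsto (fun n => ∫ t, inner ℝ (w n t) (φ t)) atTop (𝓝 (∫ t, inner ℝ (w₀ t) (φ t) : ℝ)) := by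
  obtain ⟨T₀, C, hT₀, hC0, hC⟩ := exists_support_bounds hφ hc
  set T := max a T₀
  have haT : a ≤ T := le_max_left _ _
  have hint : ∀ k : ℝ → H, Continuous k → Integrable (fun t => (inner ℝ (k t) (φ t) : ℝ)) volume :=
    fun k hk => (hk.inner hφ).integrable_of_hasCompactSupport
      (HasCompactSupport.intro hc.isCompact fun t ht => by
        rw [image_eq_zero_of_notMem_tsupport ht, inner_zero_right])
  rw [tendsto_iff_norm_sub_tendsto_zero]
  have hlim : Tendsto (fun n => (∫ s in a..T, ‖w n s - w₀ s‖) * C) atTop (𝓝 0) := by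
    simpa using (hl T).mul_const C
  refine squeeze_zero (fun _ => norm_nonneg _) (fun n => ?_) hlim
  rw [← integral_sub (hint _ (hw n).cont) (hint _ hw₀.cont), ← intervalIntegral.integral_mul_const,
    intervalIntegral.integral_of_le haT, ← integral_indicator measurableSet_Ioc]
  refine norm_integral_le_of_norm_le ?_ (Eventually.of_forall fun t => ?_)
  · rw [integrable_indicator_iff measurableSet_Ioc]
    exact ((((hw n).cont.sub hw₀.cont).norm.mul continuous_const).continuousOn.integrableOn_compact
      isCompact_Icc).mono_set Ioc_subset_Icc_self
  · rw [← inner_sub_left]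
    by_cases ht : t ∈ Ioc a T
    · rw [indicator_of_mem ht]
      exact (norm_inner_le_norm _ _).trans (mul_le_mul_of_nonneg_left (hC t) (norm_nonneg _))
    · rw [indicator_of_notMem ht]
      rcases not_and_or.1 ht with h | h
      · simp [(hw n).vanish t (not_lt.1 h), hw₀.vanish t (not_lt.1 h)]
      · simp [hT₀ t ((le_max_right _ _).trans_lt (not_le.1 h))]

lemma tendsto_integral_norm_of_tendstoUniformlyOn {w : ℕ → ℝ → H} {w₀ : ℝ → H}
    (hl : ∀ T, TendstoUniformlyOn w w₀ atTop (Iic T)) (T : ℝ) :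
    Tendsto (fun n => ∫ s in a..T, ‖w n s - w₀ s‖) atTop (𝓝 0) := by
  rw [Metric.tendsto_nhds]
  intro ε hε
  filter_upwards [Metric.tendstoUniformlyOn_iff.1 (hl (max a T)) (ε / (|T - a| + 1)) (by positivity)]
    with n hn
  rw [dist_zero_right]
  refine (intervalIntegral.norm_integral_le_of_norm_le_const (C := ε / (|T - a| + 1))
    fun s hs => ?_).trans_lt ?_
  · rw [norm_norm, ← dist_eq_norm, dist_comm]
    exact (hn s hs.2).le
  · rw [div_mul_eq_mul_div, div_lt_iff₀ (by positivity)]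
    nlinarith

/-- Limits of strong solutions satisfy the weak formulation. -/
lemma weak_eq_of_tendsto (h : SkewPair J D) (hA : IsSelfAdjoint A) (hQ : IsKernel Q)
    {F y y' : ℕ → ℝ → H} {F₀ y₀ : ℝ → H} (hF : ∀ n, ContCausal a (F n)) (hF₀ : ContCausal a F₀)
    (hFl : ∀ T, Tendsto (fun n => ∫ s in a..T, ‖F n s - F₀ s‖) atTop (𝓝 0))
    (hy : ∀ n, StrongSol J D A B Q a (F n) (y n) (y' n)) (hy₀ : ContCausal a y₀)
    (hyl : ∀ T, TendstoUniformlyOn y y₀ atTop (Iic T)) {φ : ℝ → V} (hφ : ContDiff ℝ ∞ φ)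
    (hc : HasCompactSupport φ) :
    ∫ t, inner ℝ (y₀ t) (A (J (deriv φ t)) + D (φ t) - B.adjoint (J (φ t))
        - memoryAdj Q (fun s => J (φ s)) t) = -∫ t, inner ℝ (F₀ t) (J (φ t)) := by
  rw [weakForm_eq hQ hy₀ hφ hc]
  have hyc : ∀ n, ContCausal a (y n) := fun n => by
    obtain ⟨v, -, hs⟩ := hy n
    exact hs.contCausal
  have hφ0 := hφ.continuous
  have hφ' : Continuous (deriv φ) := hφ.continuous_deriv (by simp)
  have hJφ : Continuous fun t => J (φ t) := by fun_prop
  have hcJ : HasCompactSupport fun t => J (φ t) := hc.comp_left (map_zero J)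
  have h1 := tendsto_integral_inner hyc hy₀ (tendsto_integral_norm_of_tendstoUniformlyOn hyl)
    (φ := fun t => A (J (deriv φ t)) + D (φ t) - B.adjoint (J (φ t))) (by fun_prop)
    (HasCompactSupport.intro hc.isCompact fun t ht => by
      have h1 : φ t = 0 := image_eq_zero_of_notMem_tsupport ht
      have h2 : deriv φ t = 0 := by
        by_contra h
        exact ht (support_deriv_subset h)
      simp [h1, h2])
  have h2 := tendsto_integral_inner (fun n => hQ.contCausal_memory (hyc n))
    (hQ.contCausal_memory hy₀) (tendsto_integral_norm_of_tendstoUniformlyOn fun T =>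
      hQ.tendstoUniformlyOn_memory hyc hy₀ (hyl T)) hJφ hcJ
  have h3 := tendsto_integral_inner hF hF₀ hFl hJφ hcJ
  exact tendsto_nhds_unique (h1.sub h2)
    (h3.neg.congr fun n => ((hy n).weak_eq h hA hQ (hF n).cont hφ hc).symm)

end Weak

/-! ### Stability and uniqueness of strong and weak solutions -/

section StrongSolutions

variable {H : Type*} [NormedAddCommGroup H] [InnerProductSpace ℝ H] [CompleteSpace H]
variable {V : Type*} [NormedAddCommGroup V] [InnerProductSpace ℝ V] [CompleteSpace V]
variable {J D : V →L[ℝ] H} {A B : H →L[ℝ] H} {Q : ℝ → H →L[ℝ] H} {a c q : ℝ}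

lemma StrongSol.contCausal {f u u' : ℝ → H} (hs : StrongSol J D A B Q a f u u') :
    ContCausal a u := by
  obtain ⟨v, -, hs⟩ := hs
  exact hs.contCausal

lemma StrongSol.deriv_contCausal {f u u' : ℝ → H} (hs : StrongSol J D A B Q a f u u') :
    ContCausal a u' := by
  obtain ⟨v, -, hs⟩ := hs
  exact hs.deriv_contCausal

lemma StrongSol.hasDerivAt {f u u' : ℝ → H} (hs : StrongSol J D A B Q a f u u') (t : ℝ) :
    HasDerivAt u (u' t) t := by
  obtain ⟨v, -, hs⟩ := hs
  exact hs.deriv t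

lemma StrongSol.mono {f u u' : ℝ → H} (hs : StrongSol J D A B Q a f u u') {b : ℝ} (hb : b ≤ a) :
    StrongSol J D A B Q b f u u' := by
  obtain ⟨v, hv, hs⟩ := hs
  exact ⟨v, hv, hs.cont, fun t ht => hs.vanish t (ht.trans hb), hs.deriv, hs.eqn⟩

lemma StrongSol.sub (hQ : IsKernel Q) {f₁ u₁ u₁' f₂ u₂ u₂' : ℝ → H}
    (h₁ : StrongSol J D A B Q a f₁ u₁ u₁') (h₂ : StrongSol J D A B Q a f₂ u₂ u₂') :
    StrongSol J D A B Q a (fun t => f₁ t - f₂ t) (fun t => u₁ t - u₂ t) (fun t => u₁' t - u₂' t) := by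
  obtain ⟨v₁, hv₁, hs₁⟩ := h₁
  obtain ⟨v₂, hv₂, hs₂⟩ := h₂
  refine ⟨fun t => v₁ t - v₂ t, fun t => by rw [map_sub, hv₁, hv₂], ?_⟩
  simp_rw [map_sub]
  exact hs₁.sub hQ hs₂

lemma StrongSol.smul (r : ℝ) {f u u' : ℝ → H} (hs : StrongSol J D A B Q a f u u') :
    StrongSol J D A B Q a (fun t => r • f t) (fun t => r • u t) (fun t => r • u' t) := by
  obtain ⟨v, hv, hs⟩ := hs
  refine ⟨fun t => r • v t, fun t => by rw [map_smul, hv], hs.cont.const_smul r,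
    (hs.contCausal.smul r).vanish, fun t => (hs.deriv t).const_smul r, fun t => ?_⟩
  rw [memory_smul, ← hs.eqn t]
  simp only [map_smul, smul_add]

/-- A solution for the coefficients `(A, B, Q)` solves the problem with perturbed coefficients, with
a modified right-hand side. -/
lemma StrongSol.perturb {f u u' : ℝ → H} (hs : StrongSol J D A B Q a f u u') (hQ : IsKernel Q)
    (δA δB : H →L[ℝ] H) {δQ : ℝ → H →L[ℝ] H} (hδQ : IsKernel δQ) (r : ℝ) :
    StrongSol J D (A + r • δA) (B + r • δB) (fun t => Q t + r • δQ t) a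
      (fun t => f t + r • (δA (u' t) + δB (u t) + memory δQ u t)) u u' := by
  obtain ⟨v, hv, hs⟩ := hs
  refine ⟨v, hv, hs.cont, hs.vanish, hs.deriv, fun t => ?_⟩
  rw [memory_add_smul_kernel hQ hδQ r hs.contCausal, ← hs.eqn t]
  simp only [add_apply, smul_apply, smul_add]
  abel

/-- Strong solutions are stable in terms of the right-hand side, uniformly in the coefficients. -/
theorem strongSol_stability (h : SkewPair J D) {T : ℝ} (q : ℝ) (hc : 0 < c) (haT : a ≤ T) :
    ∃ K, 0 < K ∧ ∀ (A B : H →L[ℝ] H) (Q : ℝ → H →L[ℝ] H), CoeffBound c q A B Q →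
      ∀ f₁ u₁ u₁' f₂ u₂ u₂' : ℝ → H, StrongSol J D A B Q a f₁ u₁ u₁' →
      StrongSol J D A B Q a f₂ u₂ u₂' → Continuous (fun t => f₁ t - f₂ t) →
      ∀ t ≤ T, ‖u₁ t - u₂ t‖ ≤ K * ∫ s in a..T, ‖f₁ s - f₂ s‖ := by
  obtain ⟨K, hK, hKe⟩ := evolSol_energy (H := H) q hc haT
  refine ⟨√K, by positivity, fun A B Q hC f₁ u₁ u₁' f₂ u₂ u₂' h₁ h₂ hf t ht => ?_⟩
  obtain ⟨v, hv, hs⟩ := h₁.sub hC.kernel h₂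
  refine le_of_sq_le_mul_sq hK.le (intervalIntegral.integral_nonneg haT fun _ _ => norm_nonneg _) ?_
  refine hKe A B Q hC _ _ _ _ 0 hs le_rfl (fun s _ => ?_) hf t ht
  rw [neg_zero, ← show J (v s) = u₁ s - u₂ s from hv s, h.skew]

theorem StrongSol.unique (h : SkewPair J D) (hC : CoeffBound c q A B Q) {f u₁ u₁' u₂ u₂' : ℝ → H}
    (h₁ : StrongSol J D A B Q a f u₁ u₁') (h₂ : StrongSol J D A B Q a f u₂ u₂') : u₁ = u₂ := by
  ext t
  obtain ⟨K, -, hK⟩ := strongSol_stability (T := max a t) h q hC.pos (le_max_left a t)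
  have := hK A B Q hC f u₁ u₁' f u₂ u₂' h₁ h₂ (by simp_rw [sub_self]; exact continuous_const) t
    (le_max_right _ _)
  simpa [sub_eq_zero] using this

/-! ### Passage between the two notions of strong solution -/

section Conversion

variable {P : H →ₗ.[ℝ] H} {e : V ≃ₗ[ℝ] P.domain}

/-- Continuity in `V` comes for free: `D v` is continuous because every other term of the equation
is, and the `V` norm is controlled by the graph norm. -/
lemma StrongSol.isStrongSolution (h : SkewPair J D) (hJ : ∀ v, J v = e v) (hD : ∀ v, D v = P (e v))
    (hQ : IsKernel Q) {f u u' : ℝ → H} (hf : Continuous f) (hs : StrongSol J D A B Q a f u u') :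
    IsStrongSolution P e A B Q f u := by
  have hu := hs.contCausal
  obtain ⟨v, hv, hs⟩ := hs
  have hd : deriv u = u' := funext fun t => (hs.deriv t).deriv
  have hDv : Continuous fun t => D (v t) := by
    have h1 : (fun t => D (v t)) = fun t => f t - A (u' t) - B (u t) - memory Q u t := by
      ext t
      rw [← hs.eqn t]
      abel
    rw [h1]
    have h2 := hs.cont
    have h3 := hu.cont
    have h4 := (hQ.contCausal_memory hu).cont
    fun_prop
  have hvc : Continuous v := by
    obtain ⟨k, hk, hlow⟩ := h.lower
    rw [continuous_iff_continuousAt]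
    intro t
    rw [ContinuousAt, tendsto_iff_norm_sub_tendsto_zero]
    have h1 : Continuous fun s => k⁻¹ * √(‖u s - u t‖ ^ 2 + ‖D (v s) - D (v t)‖ ^ 2) :=
      continuous_const.mul (((hu.cont.sub continuous_const).norm.pow 2).add
        ((hDv.sub continuous_const).norm.pow 2)).sqrt
    have h2 := h1.tendsto t
    simp only [sub_self, norm_zero, ne_eq, OfNat.ofNat_ne_zero, not_false_eq_true, zero_pow,
      add_zero, Real.sqrt_zero, mul_zero] at h2
    refine squeeze_zero (fun _ => norm_nonneg _) (fun s => ?_) h2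
    rw [inv_mul_eq_div, le_div_iff₀ hk, ← hv, ← hv, ← map_sub, ← map_sub, mul_comm]
    exact hlow _
  refine ⟨?_, hu.memL2Plus, v, hvc, fun t => by rw [← hJ, hv], fun t => ?_⟩
  · rw [contDiff_one_iff_deriv, hd]
    exact ⟨fun t => (hs.deriv t).differentiableAt, hs.cont⟩
  · rw [hd, ← hD]
    exact hs.eqn t

lemma IsStrongSolution.exists_strongSol (hJ : ∀ v, J v = e v) (hD : ∀ v, D v = P (e v))
    {f u : ℝ → H} (hs : IsStrongSolution P e A B Q f u) (hu : IsCausal u) :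
    ∃ b, StrongSol J D A B Q b f u (deriv u) := by
  obtain ⟨b, hb⟩ := hu.exists_contCausal hs.contDiff.continuous
  obtain ⟨w, -, hw, heq⟩ := hs.eqn
  refine ⟨b, w, fun t => by rw [hJ, hw], hs.contDiff.continuous_deriv le_rfl, hb.vanish,
    fun t => (hs.contDiff.differentiable (by simp) t).hasDerivAt, fun t => ?_⟩
  rw [hD]
  exact heq t

lemma IsStrongSolution.unique (h : SkewPair J D) (hJ : ∀ v, J v = e v) (hD : ∀ v, D v = P (e v))
    (hC : CoeffBound c q A B Q) {f u v : ℝ → H} (hu : IsStrongSolution P e A B Q f u)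
    (huc : IsCausal u) (hv : IsStrongSolution P e A B Q f v) (hvc : IsCausal v) : v = u := by
  obtain ⟨b₁, h₁⟩ := hu.exists_strongSol hJ hD huc
  obtain ⟨b₂, h₂⟩ := hv.exists_strongSol hJ hD hvc
  exact (h₂.mono (min_le_right b₁ b₂)).unique h hC (h₁.mono (min_le_left b₁ b₂))

end Conversion

/-! ### Uniqueness of weak solutions by mollification in time -/

section WeakUniqueness

open scoped Convolution

lemma MemL2Plus.locallyIntegrable {v : ℝ → H} (hv : MemL2Plus v) : LocallyIntegrable v volume := by
  intro t
  refine ⟨Ioc (t - 1) (t + 1), Ioc_mem_nhds (by linarith) (by linarith), ?_⟩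
  have h1 : MemLp v 2 (volume.restrict (Ioc (t - 1) (t + 1))) :=
    (hv (t + 1)).mono_measure (Measure.restrict_mono Ioc_subset_Iic_self le_rfl)
  exact h1.integrable (by norm_num)

lemma IsCausal.integrableOn_Iic {v : ℝ → H} (hv : IsCausal v) (hl : LocallyIntegrable v volume)
    (T : ℝ) : IntegrableOn v (Iic T) volume := by
  obtain ⟨b, hb⟩ := hv
  refine (hl.integrableOn_isCompact (isCompact_Icc (a := b) (b := T))).of_ae_sdiff_eq_zero
    measurableSet_Iic.nullMeasurableSet ?_
  filter_upwards [hb] with t ht hmem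
  refine ht ?_
  by_contra h
  exact hmem.2 ⟨not_lt.1 h, hmem.1⟩

/-- Mollified weak solutions are strong solutions. -/
theorem strongSol_convolution (h : SkewPair J D) (hA : IsSelfAdjoint A) (hQ : IsKernel Q) {v F : ℝ → H}
    (hv : LocallyIntegrable v volume) (hvc : IsCausal v) (hF : LocallyIntegrable F volume)
    (hweak : ∀ φ : ℝ → V, ContDiff ℝ ∞ φ → HasCompactSupport φ →
      ∫ t, inner ℝ (v t) (A (J (deriv φ t)) + D (φ t) - B.adjoint (J (φ t))
        - memoryAdj Q (fun s => J (φ s)) t) = -∫ t, inner ℝ (F t) (J (φ t)))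
    {ρ : ℝ → ℝ} (hρ : ContDiff ℝ ∞ ρ) (hρc : HasCompactSupport ρ) :
    ∃ b, StrongSol J D A B Q b (ρ ⋆[ContinuousLinearMap.lsmul ℝ ℝ, volume] F)
      (ρ ⋆[ContinuousLinearMap.lsmul ℝ ℝ, volume] v)
      (deriv ρ ⋆[ContinuousLinearMap.lsmul ℝ ℝ, volume] v) := by
  set vρ := ρ ⋆[ContinuousLinearMap.lsmul ℝ ℝ, volume] v with hvρ
  have hρ' : Continuous (deriv ρ) := hρ.continuous_deriv (by simp)
  have hρc' : HasCompactSupport (deriv ρ) := hρc.deriv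
  have hder : ∀ t, HasDerivAt vρ ((deriv ρ ⋆[ContinuousLinearMap.lsmul ℝ ℝ, volume] v) t) t :=
    fun t => hρc.hasDerivAt_convolution_left _ (hρ.of_le (by simp)) hv t
  have hcont' : Continuous (deriv ρ ⋆[ContinuousLinearMap.lsmul ℝ ℝ, volume] v) :=
    hρc'.continuous_convolution_left _ hρ' hv
  obtain ⟨b, hb⟩ := id hvc
  obtain ⟨R, hR, hR0⟩ := hρc.exists_pos_le_norm
  have hvan : ∀ t ≤ b - R, vρ t = 0 := by
    intro t ht
    rw [hvρ, convolution_lsmul_swap]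
    refine integral_eq_zero_of_ae ?_
    filter_upwards [hb] with s hs
    by_cases hsb : s < b
    · simp [hs hsb]
    · rw [hR0 (t - s) ?_]
      · simp
      · rw [Real.norm_eq_abs, abs_sub_comm]
        exact le_trans (by linarith [not_lt.1 hsb]) (le_abs_self _)
  have hcc : ContCausal (b - R) vρ :=
    ⟨continuous_iff_continuousAt.2 fun t => (hder t).continuousAt, hvan⟩
  have hshift : ∀ η : ℝ → ℝ, HasCompactSupport η → ∀ t, HasCompactSupport fun s => η (t - s) :=
    fun η hη t => hη.comp_homeomorph (Homeomorph.subLeft t)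
  have hpair : ∀ (w : ℝ → H), LocallyIntegrable w volume → ∀ η : ℝ → ℝ, Continuous η →
      HasCompactSupport η → ∀ (t : ℝ) (y : H),
      Integrable (fun s => inner ℝ (w s) (η (t - s) • y)) volume ∧
      ∫ s, inner ℝ (w s) (η (t - s) • y) =
        inner ℝ ((η ⋆[ContinuousLinearMap.lsmul ℝ ℝ, volume] w) t) y := by
    intro w hw η hη hηc t y
    have h1 : Integrable (fun s => η (t - s) • w s) volume :=
      hw.integrable_smul_left_of_hasCompactSupport (hη.comp (by fun_prop)) (hshift η hηc t)
    have h2 : (fun s => inner ℝ (w s) (η (t - s) • y)) = fun s => (inner ℝ y (η (t - s) • w s) : ℝ) := by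
      ext s
      rw [inner_smul_right, inner_smul_right, real_inner_comm]
    rw [h2]
    refine ⟨h1.const_inner y, ?_⟩
    rw [integral_inner h1, convolution_lsmul_swap, real_inner_comm]
  -- Testing with `s ↦ ρ (t - s) • x` for all `x` in `V` gives an adjoint identity for `vρ t`;
  -- maximality then places `vρ t` in the domain and yields the equation at `t`.
  have key : ∀ t, ∃ y, J y = vρ t ∧
      D y = (ρ ⋆[ContinuousLinearMap.lsmul ℝ ℝ, volume] F) t -
        A ((deriv ρ ⋆[ContinuousLinearMap.lsmul ℝ ℝ, volume] v) t) - B (vρ t) - memory Q vρ t := by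
    intro t
    have hmax := h.maximal (vρ t) (A ((deriv ρ ⋆[ContinuousLinearMap.lsmul ℝ ℝ, volume] v) t) +
      B (vρ t) + memory Q vρ t - (ρ ⋆[ContinuousLinearMap.lsmul ℝ ℝ, volume] F) t) fun x => ?_
    · obtain ⟨y, hy, hy'⟩ := hmax
      refine ⟨y, hy, ?_⟩
      rw [hy']
      abel
    have hφ : ContDiff ℝ ∞ fun s => ρ (t - s) • x := (hρ.comp (by fun_prop)).smul contDiff_const
    have hφc : HasCompactSupport fun s => ρ (t - s) • x := (hshift ρ hρc t).smul_right
    have hφJ : Continuous fun s => J (ρ (t - s) • x) := J.continuous.comp hφ.continuous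
    have hφd : ∀ s, deriv (fun s => ρ (t - s) • x) s = -(deriv ρ (t - s) • x) := by
      intro s
      have h1 : HasDerivAt ρ (deriv ρ (t - s)) (t - s) := (hρ.differentiable (by simp) _).hasDerivAt
      have h2 := (h1.comp_const_sub t s).smul_const x
      rw [neg_smul] at h2
      exact h2.deriv
    have hw := hweak _ hφ hφc
    have hmem := hQ.integral_inner_memoryAdj hv.aestronglyMeasurable (hvc.integrableOn_Iic hv) hφJ
      (hφc.comp_left (map_zero J))
    -- Mollification commutes with the memory operator: for fixed `σ`, the self-adjoint `Q σ` is
    -- moved onto `J x` and the `s`-integral becomes `vρ (t - σ)`.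
    have hmem2 : ∫ s, inner ℝ (v s) (memoryAdj Q (fun s => J (ρ (t - s) • x)) s) =
        inner ℝ (memory Q vρ t) (J x) := by
      rw [hmem.2, memory_eq, real_inner_comm, ← integral_inner (hQ.integrable_apply hcc t)]
      refine integral_congr_ae (Eventually.of_forall fun σ => ?_)
      have h1 : ∀ s, inner ℝ (Q σ (v s)) (J (ρ (t - (σ + s)) • x)) =
          inner ℝ (v s) (ρ (t - σ - s) • Q σ (J x)) := by
        intro s
        have h2 : inner ℝ (Q σ (v s)) (J x) = inner ℝ (v s) (Q σ (J x)) :=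
          (hQ.symm σ).isSymmetric _ _
        rw [map_smul, inner_smul_right, inner_smul_right, h2, sub_sub]
      have h3 : inner ℝ (Q σ (vρ (t - σ))) (J x) = inner ℝ (vρ (t - σ)) (Q σ (J x)) :=
        (hQ.symm σ).isSymmetric _ _
      simp only [h1]
      rw [(hpair v hv ρ hρ.continuous hρc (t - σ) _).2, ← hvρ, ← h3, real_inner_comm]
    have p1 := hpair v hv (deriv ρ) hρ' hρc' t (A (J x))
    have p2 := hpair v hv ρ hρ.continuous hρc t (D x)
    have p3 := hpair v hv ρ hρ.continuous hρc t (B.adjoint (J x))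
    have p4 := hpair F hF ρ hρ.continuous hρc t (J x)
    have hLHS : ∀ s, inner ℝ (v s) (A (J (deriv (fun s => ρ (t - s) • x) s)) + D (ρ (t - s) • x) -
        B.adjoint (J (ρ (t - s) • x)) - memoryAdj Q (fun s => J (ρ (t - s) • x)) s) =
        -inner ℝ (v s) (deriv ρ (t - s) • A (J x)) + inner ℝ (v s) (ρ (t - s) • D x) -
          inner ℝ (v s) (ρ (t - s) • B.adjoint (J x)) -
          inner ℝ (v s) (memoryAdj Q (fun s => J (ρ (t - s) • x)) s) := by
      intro s
      rw [hφd, inner_sub_right, inner_sub_right, inner_add_right]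
      simp only [map_neg, map_smul, inner_neg_right]
    simp_rw [hLHS, map_smul J] at hw
    simp_rw [map_smul J] at hmem hmem2
    have hsum : ∀ f g k m : ℝ → ℝ, Integrable f volume → Integrable g volume →
        Integrable k volume → Integrable m volume →
        ∫ s, (-f s + g s - k s - m s) = -(∫ s, f s) + (∫ s, g s) - (∫ s, k s) - ∫ s, m s := by
      intro f g k m hf hg hk hm
      have i1 : Integrable (fun s => -f s) volume := hf.neg
      have i2 : Integrable (fun s => -f s + g s) volume := i1.add hg
      have i3 : Integrable (fun s => -f s + g s - k s) volume := i2.sub hk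
      rw [integral_sub i3 hm, integral_sub i2 hk, integral_add i1 hg, integral_neg]
    rw [hsum _ _ _ _ p1.1 p2.1 p3.1 hmem.1, p1.2, p2.2, p3.2, p4.2, hmem2,
      ContinuousLinearMap.adjoint_inner_right] at hw
    have hA' : inner ℝ ((deriv ρ ⋆[ContinuousLinearMap.lsmul ℝ ℝ, volume] v) t) (A (J x)) =
        inner ℝ (A ((deriv ρ ⋆[ContinuousLinearMap.lsmul ℝ ℝ, volume] v) t)) (J x) :=
      (hA.isSymmetric _ _).symm
    rw [inner_sub_left, inner_add_left, inner_add_left]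
    rw [hA'] at hw
    linarith
  choose y hy hy' using key
  refine ⟨b - R, y, hy, hcont', hvan, hder, fun t => ?_⟩
  rw [hy']
  abel

/-- Causal weak solutions are unique. -/
theorem weak_unique (h : SkewPair J D) (hC : CoeffBound c q A B Q) {v w F : ℝ → H}
    (hv : LocallyIntegrable v volume) (hvc : IsCausal v) (hw : LocallyIntegrable w volume)
    (hwc : IsCausal w) (hF : LocallyIntegrable F volume)
    (hvw : ∀ φ : ℝ → V, ContDiff ℝ ∞ φ → HasCompactSupport φ →
      ∫ t, inner ℝ (v t) (A (J (deriv φ t)) + D (φ t) - B.adjoint (J (φ t))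
        - memoryAdj Q (fun s => J (φ s)) t) = -∫ t, inner ℝ (F t) (J (φ t)))
    (hww : ∀ φ : ℝ → V, ContDiff ℝ ∞ φ → HasCompactSupport φ →
      ∫ t, inner ℝ (w t) (A (J (deriv φ t)) + D (φ t) - B.adjoint (J (φ t))
        - memoryAdj Q (fun s => J (φ s)) t) = -∫ t, inner ℝ (F t) (J (φ t))) :
    v =ᵐ[volume] w := by
  -- The inner radius is half the outer one; a bounded ratio is what almost everywhere convergence
  -- of the mollifications requires.
  let β : ℕ → ContDiffBump (0 : ℝ) := fun n =>
    ⟨1 / ((n : ℝ) + 1) / 2, 1 / ((n : ℝ) + 1), by positivity, half_lt_self (by positivity)⟩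
  have hβ : Tendsto (fun n => (β n).rOut) atTop (𝓝 0) :=
    tendsto_one_div_add_atTop_nhds_zero_nat (𝕜 := ℝ)
  have hβ2 : ∀ᶠ n in atTop, (β n).rOut ≤ 2 * (β n).rIn :=
    Eventually.of_forall fun n => by
      show 1 / ((n : ℝ) + 1) ≤ 2 * (1 / ((n : ℝ) + 1) / 2)
      rw [mul_div_cancel₀ _ two_ne_zero]
  filter_upwards [ContDiffBump.ae_convolution_tendsto_right_of_locallyIntegrable hβ hβ2 hv,
    ContDiffBump.ae_convolution_tendsto_right_of_locallyIntegrable hβ hβ2 hw] with t ht₁ ht₂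
  refine tendsto_nhds_unique ht₁ (ht₂.congr fun n => ?_)
  -- Both mollifications are strong solutions for the same mollified `F`, hence they coincide for
  -- every `n`.
  obtain ⟨b₁, h₁⟩ := strongSol_convolution h hC.symm hC.kernel hv hvc hF hvw
    (ContDiffBump.contDiff_normed (β n) (n := ⊤) (μ := volume)) (β n).hasCompactSupport_normed
  obtain ⟨b₂, h₂⟩ := strongSol_convolution h hC.symm hC.kernel hw hwc hF hww
    (ContDiffBump.contDiff_normed (β n) (n := ⊤) (μ := volume)) (β n).hasCompactSupport_normed
  exact congrFun ((h₂.mono (min_le_right b₁ b₂)).unique h hC (h₁.mono (min_le_left b₁ b₂))) t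

end WeakUniqueness

end StrongSolutions

/-! ### Perturbed coefficients and the derivative of the solution -/

section Differentiability

variable {H : Type*} [NormedAddCommGroup H] [InnerProductSpace ℝ H] [CompleteSpace H]
variable {V : Type*} [NormedAddCommGroup V] [InnerProductSpace ℝ V] [CompleteSpace V]
variable {J D : V →L[ℝ] H} {A B δA δB : H →L[ℝ] H} {Q δQ : ℝ → H →L[ℝ] H} {a c q : ℝ}

lemma IsKernel.add_smul (hQ : IsKernel Q) (hδQ : IsKernel δQ) (r : ℝ) :
    IsKernel fun t => Q t + r • δQ t where
  integrable := hQ.integrable.add (hδQ.integrable.smul r)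
  symm t := (hQ.symm t).add ((IsSelfAdjoint.all r).smul (hδQ.symm t))
  continuousOn := hQ.continuousOn.add (hδQ.continuousOn.const_smul r)
  causal t ht := by simp [hQ.causal t ht, hδQ.causal t ht]

lemma OperatorBounds.add_smul {C : ℝ} (hA : OperatorBounds c C A) (δA : H →L[ℝ] H) {r : ℝ}
    (hr : |r| * ‖δA‖ ≤ c / 2) : OperatorBounds (c / 2) (C + c / 2) (A + r • δA) := by
  intro x
  have h1 : inner ℝ ((A + r • δA) x) x = inner ℝ (A x) x + r * inner ℝ (δA x) x := by
    rw [add_apply, smul_apply, inner_add_left, inner_smul_left]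
    rfl
  have h2 : |r * inner ℝ (δA x) x| ≤ c / 2 * ‖x‖ ^ 2 := by
    rw [abs_mul]
    calc |r| * |inner ℝ (δA x) x| ≤ |r| * (‖δA‖ * ‖x‖ * ‖x‖) := by
          gcongr
          exact (abs_real_inner_le_norm _ _).trans (by gcongr; exact δA.le_opNorm x)
      _ = |r| * ‖δA‖ * ‖x‖ ^ 2 := by ring
      _ ≤ c / 2 * ‖x‖ ^ 2 := by gcongr
  have h3 := abs_le.1 h2
  rw [h1]
  constructor <;> linarith [(hA x).1, (hA x).2]

/-- Neither constant depends on `r`, which makes the stability constant uniform in the perturbation.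
Only the `L¹` norm of the kernels enters, so `δQ` may be unbounded. -/
lemma coeffBound_add_smul {C : ℝ} (hc : 0 < c) (hAs : IsSelfAdjoint A) (hA : OperatorBounds c C A)
    (hδA : IsSelfAdjoint δA) (B δB : H →L[ℝ] H) (hQ : IsKernel Q) (hδQ : IsKernel δQ) {r : ℝ}
    (hr : |r| * ‖δA‖ ≤ c / 2) (hr1 : |r| ≤ 1) :
    CoeffBound (c / 2) (‖B‖ + ‖δB‖ + ((∫ σ, ‖Q σ‖) + ∫ σ, ‖δQ σ‖)) (A + r • δA) (B + r • δB)
      (fun t => Q t + r • δQ t) where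
  pos := half_pos hc
  symm := hAs.add ((IsSelfAdjoint.all r).smul hδA)
  coercive x := ((hA.add_smul δA hr) x).1
  kernel := hQ.add_smul hδQ r
  bound := by
    have h0 : ∀ {E : Type _} [NormedAddCommGroup E] [NormedSpace ℝ E] (x y : E),
        ‖x + r • y‖ ≤ ‖x‖ + ‖y‖ := by
      intro E _ _ x y
      refine norm_add_le_of_le le_rfl ?_
      rw [norm_smul]
      exact mul_le_of_le_one_left (norm_nonneg _) hr1
    refine add_le_add (h0 B δB) ?_
    rw [← integral_add hQ.integrable.norm hδQ.integrable.norm]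
    exact integral_mono (hQ.add_smul hδQ r).integrable.norm
      (hQ.integrable.norm.add hδQ.integrable.norm) fun σ => h0 (Q σ) (δQ σ)

lemma mem_admissible_of_bounds {C : ℝ} (hc : 0 < c) (hcC : c ≤ C) (hAs : IsSelfAdjoint A)
    (hA : OperatorBounds c C A) (B : H →L[ℝ] H) (hQ : IsKernel Q) (hQb : eLpNorm Q ⊤ volume < ⊤) :
    (A, B, Q) ∈ admissible H := by
  refine ⟨c, C, ‖B‖, (eLpNorm Q 1 volume + eLpNorm Q ⊤ volume).toReal, hc, hcC, norm_nonneg _,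
    ENNReal.toReal_nonneg, hAs, hA, le_rfl, hQ, ?_⟩
  rw [ENNReal.ofReal_toReal]
  exact ENNReal.add_ne_top.2 ⟨(memLp_one_iff_integrable.2 hQ.integrable).2.ne, hQb.ne⟩

lemma eLpNorm_top_add_smul_lt (hQb : eLpNorm Q ⊤ volume < ⊤) {M : ℝ} (hM : ∀ t, ‖δQ t‖ ≤ M) (r : ℝ) :
    eLpNorm (fun t => Q t + r • δQ t) ⊤ volume < ⊤ := by
  rw [eLpNorm_exponent_top] at hQb ⊢
  refine (eLpNormEssSup_le_of_ae_bound (C := (eLpNormEssSup Q volume).toReal + |r| * M) ?_).trans_lt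
    ENNReal.ofReal_lt_top
  filter_upwards [ae_le_eLpNormEssSup (f := Q) (μ := volume)] with t ht
  refine norm_add_le_of_le ?_ ?_
  · rw [← toReal_enorm]
    exact ENNReal.toReal_mono hQb.ne ht
  · rw [norm_smul, Real.norm_eq_abs]
    exact mul_le_mul_of_nonneg_left (hM t) (abs_nonneg r)

lemma ContCausal.prim_base_eq {w : ℝ → H} (hw : ContCausal a w) {b : ℝ} (hb : b ≤ a) :
    Evolution.prim b w = Evolution.prim a w := by
  ext t
  rw [Evolution.prim, Evolution.prim, ← intervalIntegral.integral_add_adjacent_intervals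
    (hw.cont.intervalIntegrable b a) (hw.cont.intervalIntegrable a t)]
  have h1 := prim_vanish hw.vanish b hb
  rw [Evolution.prim, intervalIntegral.integral_symm, neg_eq_zero] at h1
  rw [h1, zero_add]

/-- A continuous causal right-hand side is the limit of right-hand sides for which the problem has
strong solutions, and these solutions converge. -/
theorem exists_strongSol_approx (h : SkewPair J D) (hC : CoeffBound c q A B Q) {F : ℝ → H}
    (hF : ContCausal (a + 2) F) :
    ∃ (k y y' : ℕ → ℝ → H) (y₀ : ℝ → H), (∀ n, ContCausal a (k n)) ∧
      (∀ T, Tendsto (fun n => ∫ s in a..T, ‖k n s - F s‖) atTop (𝓝 0)) ∧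
      (∀ n, StrongSol J D A B Q a (k n) (y n) (y' n)) ∧ ContCausal a y₀ ∧
      ∀ T, TendstoUniformlyOn y y₀ atTop (Iic T) := by
  -- Of the two units of room before `F` starts, one is used by the cut-off here and the other by
  -- `exists_strongSol`.
  obtain ⟨k, hk, hkl⟩ := exists_prim_approx (a := a + 1) hF.cont.locallyIntegrable
    (fun t ht => hF.vanish t (by linarith))
  have hle : a ≤ a + 1 := by linarith
  have hex : ∀ n, ∃ y y', StrongSol J D A B Q a (prim (a + 1) (k n)) y y' := fun n => by
    rw [← (hk n).prim_base_eq hle]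
    exact exists_strongSol h hC (hk n).cont.locallyIntegrable (hk n).vanish
  choose y y' hy using hex
  have hkc : ∀ n, ContCausal a (prim (a + 1) (k n)) := fun n => (hk n).prim.mono hle
  have hkl' : ∀ T, Tendsto (fun n => ∫ s in a..T, ‖prim (a + 1) (k n) s - F s‖) atTop (𝓝 0) := by
    intro T
    refine (hkl T).congr fun n => ?_
    have h1 : ContCausal (a + 1) fun s => ‖prim (a + 1) (k n) s - F s‖ :=
      ⟨((hk n).prim.cont.sub hF.cont).norm, fun t ht => by
        rw [(hk n).prim.vanish t ht, hF.vanish t (by linarith), sub_zero, norm_zero]⟩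
    exact (congrFun (h1.prim_base_eq hle) T).symm
  have hCauchy : ∀ T, UniformCauchySeqOn y atTop (Iic T) := by
    refine uniformCauchySeqOn_of_stability (fun n => (hkc n).cont) hF.cont.locallyIntegrable hkl'
      fun T haT => ?_
    obtain ⟨K, hK, hKe⟩ := strongSol_stability h q hC.pos haT
    exact ⟨K, hK, fun m n => hKe A B Q hC _ _ _ _ _ _ (hy m) (hy n) ((hkc m).cont.sub (hkc n).cont)⟩
  obtain ⟨y₀, hy₀, hyl⟩ := exists_contCausal_limit (fun n => (hy n).contCausal) hCauchy
  exact ⟨_, y, y', y₀, hkc, hkl', hy, hy₀, hyl⟩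

/-- Convergence of the difference quotients, locally uniformly in time. -/
theorem differenceQuotient_tendsto (h : SkewPair J D) (hc : 0 < c) (hQ : IsKernel Q)
    (hδQ : IsKernel δQ) {h₀ : ℝ} (hh₀ : 0 < h₀)
    (hC : ∀ r : ℝ, |r| < h₀ →
      CoeffBound c q (A + r • δA) (B + r • δB) (fun t => Q t + r • δQ t))
    {f u u' : ℝ → H} (hu : StrongSol J D A B Q a f u u') {U U' : ℝ → ℝ → H}
    (hU : ∀ r : ℝ, |r| < h₀ →
      StrongSol J D (A + r • δA) (B + r • δB) (fun t => Q t + r • δQ t) a f (U r) (U' r))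
    {F : ℝ → H} (hF : Continuous F)
    (hFu : ∀ t, F t = -(δA (u' t) + δB (u t) + memory δQ u t)) {k y y' : ℕ → ℝ → H} {y₀ : ℝ → H}
    (hk : ∀ n, ContCausal a (k n))
    (hkl : ∀ T, Tendsto (fun n => ∫ s in a..T, ‖k n s - F s‖) atTop (𝓝 0))
    (hy : ∀ n, StrongSol J D A B Q a (k n) (y n) (y' n))
    (hyl : ∀ T, TendstoUniformlyOn y y₀ atTop (Iic T)) (T : ℝ) {ε : ℝ} (hε : 0 < ε) :
    ∀ᶠ r in 𝓝[≠] (0 : ℝ), ∀ t ≤ T, ‖r⁻¹ • (U r t - u t) - y₀ t‖ ≤ ε := by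
  suffices hmain : ∀ T, a ≤ T → ∀ᶠ r in 𝓝[≠] (0 : ℝ), ∀ t ≤ T, ‖r⁻¹ • (U r t - u t) - y₀ t‖ ≤ ε by
    filter_upwards [hmain (max a T) (le_max_left _ _)] with r hr t ht
    exact hr t (ht.trans (le_max_right _ _))
  intro T haT
  obtain ⟨K, hK, hKe⟩ := strongSol_stability (J := J) (D := D) h q hc haT
  -- The index `n` is fixed before `r`: `Z` below contains `y' n`, for which no bound uniform in `n`
  -- is available.
  obtain ⟨n, hn₁, hn₂⟩ := (((hkl T).eventually (gt_mem_nhds (show 0 < ε / (3 * K) by positivity))).and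
    (Metric.tendstoUniformlyOn_iff.1 (hyl T) (ε / 3) (by positivity))).exists
  have hyc := (hy n).contCausal
  let Z : ℝ → H := fun t => δA (y' n t) + δB (y n t) + memory δQ (y n) t
  have hZ : Continuous Z := ((((hy n).deriv_contCausal.clm δA).add (hyc.clm δB)).add
    (hδQ.contCausal_memory hyc)).cont
  set I := ∫ s in a..T, ‖Z s‖ with hI
  have hI0 : 0 ≤ I := intervalIntegral.integral_nonneg haT fun _ _ => norm_nonneg _
  have hr1 : ∀ᶠ r in 𝓝[≠] (0 : ℝ), |r| < h₀ :=
    eventually_nhdsWithin_of_eventually_nhds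
      ((continuous_abs.tendsto' 0 0 abs_zero).eventually (gt_mem_nhds hh₀))
  have hr2 : ∀ᶠ r in 𝓝[≠] (0 : ℝ), |r| < ε / (3 * K * (I + 1)) :=
    eventually_nhdsWithin_of_eventually_nhds
      ((continuous_abs.tendsto' 0 0 abs_zero).eventually (gt_mem_nhds (by positivity)))
  filter_upwards [hr1, hr2, self_mem_nhdsWithin] with r hrh hrI hr0 t ht
  have hr0' : r ≠ 0 := hr0
  -- As a solution of the perturbed equation, `u` has the right-hand side `f - r • F`; subtracting
  -- and dividing by `r` leaves exactly `F`.
  have hquot : StrongSol J D (A + r • δA) (B + r • δB) (fun t => Q t + r • δQ t) a F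
      (fun t => r⁻¹ • (U r t - u t)) (fun t => r⁻¹ • (U' r t - u' t)) := by
    have h1 := ((hU r hrh).sub (hQ.add_smul hδQ r) (hu.perturb hQ δA δB hδQ r)).smul r⁻¹
    convert! h1 using 1
    ext s
    rw [hFu, sub_add_cancel_left, smul_neg, smul_smul, inv_mul_cancel₀ hr0', one_smul]
  have hyr := (hy n).perturb hQ δA δB hδQ r
  have hest := hKe _ _ _ (hC r hrh) _ _ _ _ _ _ hquot hyr
    (hF.sub ((hk n).cont.add (hZ.const_smul r))) t ht
  have hint : ∫ s in a..T, ‖F s - (k n s + r • (δA (y' n s) + δB (y n s) + memory δQ (y n) s))‖ ≤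
      (∫ s in a..T, ‖k n s - F s‖) + |r| * I := by
    have c1 : Continuous fun s => ‖k n s - F s‖ := ((hk n).cont.sub hF).norm
    have c2 : Continuous fun s => |r| * ‖Z s‖ := continuous_const.mul hZ.norm
    rw [hI, ← intervalIntegral.integral_const_mul, ← intervalIntegral.integral_add
      (c1.intervalIntegrable _ _) (c2.intervalIntegrable _ _)]
    refine intervalIntegral.integral_mono_on haT
      ((hF.sub ((hk n).cont.add (hZ.const_smul r))).norm.intervalIntegrable _ _)
      ((c1.add c2).intervalIntegrable _ _) fun s _ => ?_
    rw [← Real.norm_eq_abs, ← norm_smul, norm_sub_rev (k n s), ← sub_sub]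
    exact norm_sub_le _ _
  have h1 : K * ((∫ s in a..T, ‖k n s - F s‖) + |r| * I) ≤ ε / 3 + ε / 3 := by
    rw [mul_add]
    refine add_le_add ?_ ?_
    · calc K * (∫ s in a..T, ‖k n s - F s‖) ≤ K * (ε / (3 * K)) := by gcongr
        _ = ε / 3 := by field_simp
    · calc K * (|r| * I) ≤ K * (ε / (3 * K * (I + 1)) * (I + 1)) := by
            gcongr
            linarith
        _ = ε / 3 := by field_simp
  have h2 : ‖y n t - y₀ t‖ ≤ ε / 3 := by
    rw [← dist_eq_norm, dist_comm]
    exact (hn₂ t ht).le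
  calc ‖r⁻¹ • (U r t - u t) - y₀ t‖
      ≤ ‖r⁻¹ • (U r t - u t) - y n t‖ + ‖y n t - y₀ t‖ := norm_sub_le_norm_sub_add_norm_sub _ _ _
    _ ≤ (ε / 3 + ε / 3) + ε / 3 :=
        add_le_add ((hest.trans (mul_le_mul_of_nonneg_left hint hK.le)).trans h1) h2
    _ = ε := by ring

lemma isWeakSolution_iff {P : H →ₗ.[ℝ] H} {e : V ≃ₗ[ℝ] P.domain} (hJ : ∀ v, J v = e v)
    (hD : ∀ v, D v = P (e v)) (F v : ℝ → H) :
    IsWeakSolution P e A B Q F v ↔ MemL2Plus v ∧ ∀ φ : ℝ → V, ContDiff ℝ ∞ φ → HasCompactSupport φ →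
      ∫ t, inner ℝ (v t) (A (J (deriv φ t)) + D (φ t) - B.adjoint (J (φ t))
        - memoryAdj Q (fun s => J (φ s)) t) = -∫ t, inner ℝ (F t) (J (φ t)) := by
  simp only [hJ, hD]
  exact ⟨fun hv => ⟨hv.1, hv.2⟩, fun hv => ⟨hv.1, hv.2⟩⟩

end Differentiability

end Evolution

/-! ### The theorem -/

theorem theorem8
    {H : Type*} [NormedAddCommGroup H] [InnerProductSpace ℝ H] [CompleteSpace H]
    [TopologicalSpace.SeparableSpace H]
    {V : Type*} [NormedAddCommGroup V] [InnerProductSpace ℝ V] [CompleteSpace V]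
    [TopologicalSpace.SeparableSpace V]
    (P : H →ₗ.[ℝ] H) (e : V ≃ₗ[ℝ] P.domain) (hP : Evolution.IsSpatialOperator P e)
    (A B : H →L[ℝ] H) (Q : ℝ → H →L[ℝ] H) (hABQ : (A, B, Q) ∈ Evolution.admissible H)
    (δA δB : H →L[ℝ] H) (δQ : ℝ → H →L[ℝ] H)
    (hδA : IsSelfAdjoint δA) (hδQ : Evolution.IsKernel δQ)
    -- `f ∈ H¹(ℝ, H)` is causal; it is given by its continuous representative
    (f : ℝ → H) (hf : Evolution.MemH1 f) (hfcont : Continuous f)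
    (hfcausal : Evolution.IsCausal f) :
    -- the causal strong solution `u` for the coefficients `(A, B, Q)`
    ∃ u : ℝ → H,
      (Evolution.IsStrongSolution P e A B Q f u ∧ Evolution.IsCausal u) ∧
      (∀ v : ℝ → H, Evolution.IsStrongSolution P e A B Q f v → Evolution.IsCausal v → v = u) ∧
    -- the causal strong solutions `U h` for the perturbed coefficients
    ∃ (h₀ : ℝ) (U : ℝ → ℝ → H), 0 < h₀ ∧
      (∀ h : ℝ, |h| < h₀ →
        Evolution.IsCoefficient (A + h • δA) (fun t => Q t + h • δQ t) ∧
        ((∃ M : ℝ, ∀ t, ‖δQ t‖ ≤ M) →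
          (A + h • δA, B + h • δB, fun t => Q t + h • δQ t) ∈ Evolution.admissible H) ∧
        (Evolution.IsStrongSolution P e (A + h • δA) (B + h • δB) (fun t => Q t + h • δQ t) f (U h)
          ∧ Evolution.IsCausal (U h)) ∧
        (∀ v : ℝ → H,
          Evolution.IsStrongSolution P e (A + h • δA) (B + h • δB) (fun t => Q t + h • δQ t) f v →
          Evolution.IsCausal v → v = U h)) ∧
    -- the causal weak solution `δu` of the linearized problem
    ∃ δu : ℝ → H,
      (Continuous δu ∧ Evolution.IsCausal δu ∧
        Evolution.IsWeakSolution P e A B Q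
          (fun t => -δA (deriv u t) - δB (u t) - Evolution.memory δQ u t) δu) ∧
      (∀ v : ℝ → H, Evolution.IsCausal v →
        Evolution.IsWeakSolution P e A B Q
          (fun t => -δA (deriv u t) - δB (u t) - Evolution.memory δQ u t) v →
        v =ᵐ[volume] δu) ∧
    -- the difference quotients converge to `δu`, locally uniformly
      ∀ T₀ T : ℝ, T₀ ≤ T →
        Tendsto
          (fun h : ℝ => eLpNorm (fun t => h⁻¹ • (U h t - u t) - δu t) ⊤
            (volume.restrict (Icc T₀ T)))
          (𝓝[≠] 0) (𝓝 0) := by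
  obtain ⟨J, D, hJD, hJ, hD⟩ := hP.exists_skewPair
  obtain ⟨c, C, _, _, hc, hcC, -, -, hAs, hA, -, hQ, hQb⟩ := hABQ
  dsimp only at hAs hA hQ hQb
  obtain ⟨b, hb⟩ := hfcausal.exists_contCausal hfcont
  obtain ⟨a, rfl⟩ : ∃ a, b = a + 1 := ⟨b - 1, by ring⟩
  obtain ⟨g, hg, hg0, hfg⟩ := hf.exists_eq_prim hb
  -- This keeps half of the coercivity constant and `|h| ≤ 1`; the `+ 1` covers `δA = 0`.
  set h₀ : ℝ := min 1 (c / (2 * (‖δA‖ + 1))) with hh₀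
  have hh₀pos : 0 < h₀ := by positivity
  have hsmall : ∀ h : ℝ, |h| < h₀ → |h| * ‖δA‖ ≤ c / 2 ∧ |h| ≤ 1 := by
    intro h hh
    refine ⟨?_, (hh.trans_le (min_le_left _ _)).le⟩
    have h1 := (hh.trans_le (min_le_right _ _)).le
    rw [le_div_iff₀ (by positivity)] at h1
    nlinarith [abs_nonneg h]
  have hCB : ∀ h : ℝ, |h| < h₀ → Evolution.CoeffBound (c / 2) _ (A + h • δA) (B + h • δB)
      (fun t => Q t + h • δQ t) := fun h hh =>
    Evolution.coeffBound_add_smul hc hAs hA hδA B δB hQ hδQ (hsmall h hh).1 (hsmall h hh).2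
  have hCB₀ : Evolution.CoeffBound c _ A B Q := ⟨hc, hAs, fun x => (hA x).1, hQ, le_rfl⟩
  obtain ⟨u, u', hu⟩ := Evolution.exists_strongSol hJD hCB₀ hg hg0
  rw [← hfg] at hu
  have hU : ∀ h : ℝ, ∃ U U', |h| < h₀ → Evolution.StrongSol J D (A + h • δA) (B + h • δB)
      (fun t => Q t + h • δQ t) a f U U' := by
    intro h
    by_cases hh : |h| < h₀
    · obtain ⟨U, U', hU⟩ := Evolution.exists_strongSol hJD (hCB h hh) hg hg0
      rw [← hfg] at hU
      exact ⟨U, U', fun _ => hU⟩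
    -- Arbitrary values outside the range of admissible `h`.
    · exact ⟨0, 0, fun h' => absurd h' hh⟩
  choose U U' hU using hU
  have huS := hu.isStrongSolution hJD hJ hD hQ hfcont
  refine ⟨u, ⟨huS, hu.contCausal.isCausal⟩,
    fun v hv hvc => huS.unique hJD hJ hD hCB₀ hu.contCausal.isCausal hv hvc, h₀, U, hh₀pos,
    fun h hh => ?_, ?_⟩
  · have hQh := hQ.add_smul hδQ h
    have hAh := hA.add_smul δA (hsmall h hh).1
    have hAhs := (hCB h hh).symm
    have hcC' : c / 2 ≤ C + c / 2 := by linarith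
    have hUS := (hU h hh).isStrongSolution hJD hJ hD hQh hfcont
    refine ⟨⟨hAhs, ⟨c / 2, C + c / 2, half_pos hc, hcC', hAh⟩, hQh⟩, ?_,
      ⟨hUS, (hU h hh).contCausal.isCausal⟩,
      fun v hv hvc => hUS.unique hJD hJ hD (hCB h hh) (hU h hh).contCausal.isCausal hv hvc⟩
    rintro ⟨M, hM⟩
    exact Evolution.mem_admissible_of_bounds (half_pos hc) hcC' hAhs hAh _ hQh
      (Evolution.eLpNorm_top_add_smul_lt
        (le_add_self.trans_lt (hQb.trans_lt ENNReal.ofReal_lt_top)) hM h)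
  have hdu : deriv u = u' := funext fun t => (hu.hasDerivAt t).deriv
  have hF : Evolution.ContCausal a (fun t => -δA (deriv u t) - δB (u t) - Evolution.memory δQ u t) := by
    rw [hdu]
    have := ((hu.deriv_contCausal.clm (-δA)).sub (hu.contCausal.clm δB)).sub
      (hδQ.contCausal_memory hu.contCausal)
    exact this
  -- The starting time is moved back to provide the two units of room needed by
  -- `exists_strongSol_approx`.
  obtain ⟨d, rfl⟩ : ∃ d, a = d + 2 := ⟨a - 2, by ring⟩
  have hd : d ≤ d + 2 := by linarith
  obtain ⟨k, y, y', δu, hk, hkl, hy, hδu, hyl⟩ := Evolution.exists_strongSol_approx hJD hCB₀ hF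
  have hweak := fun φ hφ hφc => Evolution.weak_eq_of_tendsto hJD hAs hQ (B := B) (φ := φ) hk
    (hF.mono hd) hkl hy hδu hyl hφ hφc
  have hIff := Evolution.isWeakSolution_iff (A := A) (B := B) (Q := Q) hJ hD
  refine ⟨δu, ⟨hδu.cont, hδu.isCausal, (hIff _ δu).2 ⟨hδu.memL2Plus, hweak⟩⟩, fun v hvc hv => ?_,
    fun T₀ T _ => ?_⟩
  · obtain ⟨hv1, hv2⟩ := (hIff _ v).1 hv
    exact Evolution.weak_unique hJD hCB₀ hv1.locallyIntegrable hvc hδu.cont.locallyIntegrable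
      hδu.isCausal hF.cont.locallyIntegrable hv2 hweak
  · rw [ENNReal.tendsto_nhds_zero]
    intro ε hε
    obtain ⟨r, hr0, hr⟩ := ENNReal.lt_iff_exists_nnreal_btwn.1 hε
    have hr0' : (0 : ℝ) < r := by exact_mod_cast hr0
    filter_upwards [Evolution.differenceQuotient_tendsto hJD (half_pos hc) hQ hδQ hh₀pos hCB
      (hu.mono hd) (fun h hh => (hU h hh).mono hd) hF.cont
      (fun t => by rw [hdu]; abel) hk hkl hy hyl T hr0'] with h hh
    refine le_trans ?_ hr.le
    rw [eLpNorm_exponent_top, ← ENNReal.ofReal_coe_nnreal]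
    refine eLpNormEssSup_le_of_ae_bound ?_
    filter_upwards [ae_restrict_mem measurableSet_Icc] with t ht using hh t ht.2
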